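/- An instance of the generalized complex-demand knapsack problem (GC-KP) consists of a finite list of items $k=1,\dots,n$, item $k$ having a complex demand $d_k=d_k^{\rm R}+\mathbf i\,d_k^{\rm I}$ with $d_k^{\rm R},d_k^{\rm I}\ge 0$ and a value $v_k>0$, and of three capacities $C,C^{\rm R},C^{\rm I}>0$. A set $S$ of items is feasible if $$\Big|\sum_{k\in S}d_k\Big|\le C,\qquad \sum_{k\in S}d_k^{\rm R}\le C^{\rm R},\qquad \sum_{k\in S}d_k^{\rm I}\le C^{\rm I},$$ and its value is $v(S)=\sum_{k\in S}v_k$. A $\rho$-approximation algorithm outputs on every instance a feasible set $S$ with $v(S)\ge\rho\, v(S^*)$, where $S^*$ is a feasible set of maximum value. For every $\varepsilon>0$ there is a $(\frac12-\varepsilon)$-approximation algorithm for GC-KP that runs in time polynomial in the size of the input (the polynomial may depend on $\varepsilon$). More precisely, there is one random access machine program, using the arithmetic operations $+,-,\cdot,/$ and comparisons on the data, that is a $(\frac12-\varepsilon)$-approximation algorithm both - on instances with rational data, with running time polynomial in the total number of bits of the input, every operation being charged the number of bits of its operands and result, and - on instances with real data, with running time polynomial in the number $n$ of items plus one, every real number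 having size one and every real operation having cost one (operations on the natural numbers used as indices and counters being charged their number of bits). -/

import Mathlib

noncomputable section

namespace GCKP

/-! ### The generalized complex-demand knapsack problem -/

/-- The data of a GC-KP input with numbers in `F`: `n` items, item `k` having complex demand
`dR k + i dI k` and value `v k`, and the three capacities. -/
structure Instance (F : Type) where
  n : ℕ
  dR : Fin n → F
  dI : Fin n → F
  v : Fin n → F
  C : F
  CR : F
  CI : F

namespace Instance

/-- Apply a map to all the numbers of an instance. -/
def map {F G : Type} (f : F → G) (I : Instance F) : Instance G where
  n := I.n
  dR := fun k => f (I.dR k)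
  dI := fun k => f (I.dI k)
  v := fun k => f (I.v k)
  C := f I.C
  CR := f I.CR
  CI := f I.CI

/-- The sign conditions of the problem: nonnegative real and imaginary parts of the demands,
positive values, positive capacities. -/
structure Valid (I : Instance ℝ) : Prop where
  dR_nonneg : ∀ k, 0 ≤ I.dR k
  dI_nonneg : ∀ k, 0 ≤ I.dI k
  v_pos : ∀ k, 0 < I.v k
  C_pos : 0 < I.C
  CR_pos : 0 < I.CR
  CI_pos : 0 < I.CI

/-- The complex demand of item `k`. -/
def demand (I : Instance ℝ) (k : Fin I.n) : ℂ := ⟨I.dR k, I.dI k⟩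

/-- The total value of a set of items. -/
def value (I : Instance ℝ) (S : Finset (Fin I.n)) : ℝ := ∑ k ∈ S, I.v k

/-- A set of items is feasible if its total demand respects the capacities on the magnitude, on
the real part and on the imaginary part. -/
def Feasible (I : Instance ℝ) (S : Finset (Fin I.n)) : Prop :=
  ‖∑ k ∈ S, I.demand k‖ ≤ I.C ∧
    ∑ k ∈ S, (I.demand k).re ≤ I.CR ∧ ∑ k ∈ S, (I.demand k).im ≤ I.CI

/-- An optimal solution: feasible, of maximum total value. -/
def IsOptimal (I : Instance ℝ) (S : Finset (Fin I.n)) : Prop :=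
  I.Feasible S ∧ ∀ S', I.Feasible S' → I.value S' ≤ I.value S

/-- The input size, when a number `x` of `F` has size `sz x`: the sum of the sizes of all the
numbers of the instance. -/
def size {F : Type} (sz : F → ℕ) (I : Instance F) : ℕ :=
  sz I.C + sz I.CR + sz I.CI + ∑ k, (sz (I.dR k) + sz (I.dI k) + sz (I.v k))

end Instance

/-! ### The machine model

A structured random access machine. Its memory consists of arrays of natural numbers (indices,
counters, flags) and arrays of numbers of an ordered field `F` (the data); arrays are named by
natural numbers occurring in the program text, and a scalar variable is an array used at index `0`.
A program is a finite text that does not depend on `F`. -/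

/-- Expressions with natural number values. Subtraction is truncated, division rounds down. -/
inductive NExp : Type
  | lit (m : ℕ)
  | read (a : ℕ) (i : NExp)
  | add (e f : NExp)
  | sub (e f : NExp)
  | mul (e f : NExp)
  | div (e f : NExp)
  | mod (e f : NExp)

/-- Expressions with values in the field. Literals are rational; `x / 0 = 0`. -/
inductive FExp : Type
  | lit (q : ℚ)
  | read (a : ℕ) (i : NExp)
  | add (e f : FExp)
  | sub (e f : FExp)
  | mul (e f : FExp)
  | div (e f : FExp)

/-- Tests. -/
inductive Test : Type
  | natLe (e f : NExp)
  | fldLe (e f : FExp)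
  | not (b : Test)
  | and (b c : Test)

/-- Programs. `setNat a i e` stores the value of `e` in cell `i` of the natural number array `a`;
`setFld` does the same for the field arrays. -/
inductive Program : Type
  | skip
  | setNat (a : ℕ) (i : NExp) (e : NExp)
  | setFld (a : ℕ) (i : NExp) (e : FExp)
  | seq (P Q : Program)
  | branch (b : Test) (P Q : Program)
  | loop (b : Test) (P : Program)

/-- Memory contents: `nat a i` and `fld a i` are the contents of cell `i` of array `a`. -/
structure State (F : Type) where
  nat : ℕ → ℕ → ℕ
  fld : ℕ → ℕ → F

section Semantics

variable {F : Type}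

/-- The state after storing `x` in cell `i` of the natural number array `a`. -/
def State.updNat (σ : State F) (a i x : ℕ) : State F where
  nat := Function.update σ.nat a (Function.update (σ.nat a) i x)
  fld := σ.fld

/-- The state after storing `x` in cell `i` of the field array `a`. -/
def State.updFld (σ : State F) (a i : ℕ) (x : F) : State F where
  nat := σ.nat
  fld := Function.update σ.fld a (Function.update (σ.fld a) i x)

def NExp.eval (σ : State F) : NExp → ℕ
  | .lit m => m
  | .read a i => σ.nat a (i.eval σ)
  | .add e f => e.eval σ + f.eval σ
  | .sub e f => e.eval σ - f.eval σ
  | .mul e f => e.eval σ * f.eval σ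
  | .div e f => e.eval σ / f.eval σ
  | .mod e f => e.eval σ % f.eval σ

/-- The cost of evaluating an expression (logarithmic cost): every literal, memory access and
operation costs `1` plus the number of bits of its value; the number of bits of an address and of
the operands is thereby charged too. -/
def NExp.cost (σ : State F) : NExp → ℕ
  | .lit m => 1 + Nat.size m
  | .read a i => i.cost σ + (1 + Nat.size (σ.nat a (i.eval σ)))
  | .add e f => e.cost σ + f.cost σ + (1 + Nat.size (e.eval σ + f.eval σ))
  | .sub e f => e.cost σ + f.cost σ + (1 + Nat.size (e.eval σ - f.eval σ))
  | .mul e f => e.cost σ + f.cost σ + (1 + Nat.size (e.eval σ * f.eval σ))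
  | .div e f => e.cost σ + f.cost σ + (1 + Nat.size (e.eval σ / f.eval σ))
  | .mod e f => e.cost σ + f.cost σ + (1 + Nat.size (e.eval σ % f.eval σ))

variable [Field F]

def FExp.eval (σ : State F) : FExp → F
  | .lit q => (q : F)
  | .read a i => σ.fld a (i.eval σ)
  | .add e f => e.eval σ + f.eval σ
  | .sub e f => e.eval σ - f.eval σ
  | .mul e f => e.eval σ * f.eval σ
  | .div e f => e.eval σ / f.eval σ

/-- The cost of evaluating a field expression: every literal, memory access and operation costs
`1` plus the size `sz x` of its value `x`. -/
def FExp.cost (sz : F → ℕ) (σ : State F) : FExp → ℕ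
  | .lit q => 1 + sz (q : F)
  | .read a i => i.cost σ + (1 + sz (σ.fld a (i.eval σ)))
  | .add e f => e.cost sz σ + f.cost sz σ + (1 + sz (e.eval σ + f.eval σ))
  | .sub e f => e.cost sz σ + f.cost sz σ + (1 + sz (e.eval σ - f.eval σ))
  | .mul e f => e.cost sz σ + f.cost sz σ + (1 + sz (e.eval σ * f.eval σ))
  | .div e f => e.cost sz σ + f.cost sz σ + (1 + sz (e.eval σ / f.eval σ))

variable [LinearOrder F]

/-- The truth of a test in a state. -/
def Test.Holds (σ : State F) : Test → Prop
  | .natLe e f => e.eval σ ≤ f.eval σ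
  | .fldLe e f => e.eval σ ≤ f.eval σ
  | .not b => ¬ b.Holds σ
  | .and b c => b.Holds σ ∧ c.Holds σ

/-- The cost of a test. -/
def Test.cost (sz : F → ℕ) (σ : State F) : Test → ℕ
  | .natLe e f => e.cost σ + f.cost σ + 1
  | .fldLe e f => e.cost sz σ + f.cost sz σ + 1
  | .not b => b.cost sz σ + 1
  | .and b c => b.cost sz σ + c.cost sz σ + 1

/-- `Exec sz P σ σ' t`: started in state `σ`, the program `P` halts in state `σ'`, at total
cost `t`. (Execution is deterministic: `σ'` and `t` are determined by `P` and `σ`.) -/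
inductive Exec (sz : F → ℕ) : Program → State F → State F → ℕ → Prop
  | skip (σ : State F) : Exec sz .skip σ σ 1
  | setNat (a : ℕ) (i e : NExp) (σ : State F) :
      Exec sz (.setNat a i e) σ (σ.updNat a (i.eval σ) (e.eval σ)) (i.cost σ + e.cost σ + 1)
  | setFld (a : ℕ) (i : NExp) (e : FExp) (σ : State F) :
      Exec sz (.setFld a i e) σ (σ.updFld a (i.eval σ) (e.eval σ)) (i.cost σ + e.cost sz σ + 1)
  | seq {P Q : Program} {σ σ' σ'' : State F} {s t : ℕ}
      (hP : Exec sz P σ σ' s) (hQ : Exec sz Q σ' σ'' t) : Exec sz (.seq P Q) σ σ'' (s + t)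
  | branchTrue {b : Test} {P Q : Program} {σ σ' : State F} {t : ℕ}
      (hb : b.Holds σ) (hP : Exec sz P σ σ' t) :
      Exec sz (.branch b P Q) σ σ' (b.cost sz σ + t)
  | branchFalse {b : Test} {P Q : Program} {σ σ' : State F} {t : ℕ}
      (hb : ¬ b.Holds σ) (hQ : Exec sz Q σ σ' t) :
      Exec sz (.branch b P Q) σ σ' (b.cost sz σ + t)
  | loopStop {b : Test} {P : Program} {σ : State F}
      (hb : ¬ b.Holds σ) : Exec sz (.loop b P) σ σ (b.cost sz σ)
  | loopStep {b : Test} {P : Program} {σ σ' σ'' : State F} {s t : ℕ}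
      (hb : b.Holds σ) (hP : Exec sz P σ σ' s) (hL : Exec sz (.loop b P) σ' σ'' t) :
      Exec sz (.loop b P) σ σ'' (b.cost sz σ + s + t)

/-! ### Algorithms for GC-KP -/

/-- The initial state on input `I`. The number of items is cell `0` of natural number array `0`;
the capacities `C`, `CR`, `CI` are the cells `0`, `1`, `2` of field array `0`; field arrays `1`,
`2`, `3` hold the real parts of the demands, their imaginary parts, and the values. All other
cells are `0`. -/
def Instance.init (I : Instance F) : State F where
  nat := fun a i => if a = 0 ∧ i = 0 then I.n else 0
  fld := fun a i =>
    if a = 0 then (if i = 0 then I.C else if i = 1 then I.CR else if i = 2 then I.CI else 0)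
    else if h : i < I.n then
      (if a = 1 then I.dR ⟨i, h⟩ else if a = 2 then I.dI ⟨i, h⟩
        else if a = 3 then I.v ⟨i, h⟩ else 0)
    else 0

/-- The set of items that a final state stands for: natural number array `1` holds the
indicator variables `x_k`. -/
def Instance.output {G : Type} (I : Instance G) (σ : State F) : Finset (Fin I.n) :=
  Finset.univ.filter fun k => σ.nat 1 k = 1

/-- `P` is a polynomial-time `ρ`-approximation algorithm for the instances of GC-KP with numbers
in `F`, where numbers of `F` are read as real numbers through `ι` and have size `sz`: on every
valid input `P` halts, at a cost polynomial in the input size, with a feasible solution of value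
at least `ρ` times the optimum. -/
def IsPolyTimeApprox (ι : F → ℝ) (sz : F → ℕ) (ρ : ℝ) (P : Program) : Prop :=
  ∃ p : Polynomial ℕ, ∀ I : Instance F, (I.map ι).Valid →
    ∃ (σ : State F) (t : ℕ), Exec sz P I.init σ t ∧ t ≤ p.eval (I.size sz) ∧
      (I.map ι).Feasible ((I.map ι).output σ) ∧
      ∀ S, (I.map ι).IsOptimal S → ρ * (I.map ι).value S ≤ (I.map ι).value ((I.map ι).output σ)

end Semantics

/-- The number of bits of a rational number in lowest terms (numerator and denominator). -/
def ratBits (q : ℚ) : ℕ := Nat.size q.num.natAbs + Nat.size q.den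

end GCKP

end

/-! Demands are nonnegative, so a set whose real and imaginary totals are at most those of a
feasible set is itself feasible, the magnitude bound included. It is therefore enough to match an
optimal set S by a set with no larger totals and value at least N / (2 (N + 1)) times v(S), where N
> 1 / (2 ε).

Such a set is determined by seven numbers (`exists_candidate`). Remove the two most valuable items
p, q from S, leaving S'. Let i be the item of S' with the largest real demand and s an integer such
that a_i s / N approximates the real total of S' from below up to one unit a_i / N; choose j, t
likewise for the imaginary parts. The surrogate weight w_k = a_k / (a_i s) + b_k / (b_j t) merges
the two budgets: eligible items of total weight at most 1 / N have totals no larger than S', while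
w(S') ≤ c / N with c = 2 (N + 1) / N. The 2 comes from adding two constraints, the rest from
rounding.

Order the eligible items by w / v. Those before the first overflowing item, the pivot, together with
the pivot are worth at least v(S') / c, as in the fractional knapsack problem (`greedy_bound`). The
pivot is left out, but is worth at most each of p and q. It is charged half to each, and p, q can
bear this charge on top of their own value; this is why two items are guessed.

The program enumerates all parameter vectors, encoded as the base N (n + 1) + 1 digits of a counter,
and keeps the best feasible candidate. For the bit cost it matters that only subset sums of the
input, small natural numbers and their images in the field are stored. Weights and ratios are
recomputed by expressions of fixed size. So one bound B holds for all memory cells throughout, and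
the cost is the number of rounds times a constant times B + 1 (`Triple`). Rational and real inputs
are treated together through a subadditive `SizeMeasure`. -/

noncomputable section

namespace GCKP

/-! ### The candidate sets -/

section Candidates

variable {F : Type} [Field F] [LinearOrder F]

/-- `k` comes before `m` in the order by increasing `r`, ties being broken by the index. -/
def Precedes (r : ℕ → F) (k m : ℕ) : Prop := r k < r m ∨ (r k ≤ r m ∧ k < m)

/-- The surrogate weight of item `k`: its two demands relative to `s` times the real demand of
item `i` and `t` times the imaginary demand of item `j`. -/
def weight (a b : ℕ → F) (i j : ℕ) (s t : F) (k : ℕ) : F := a k / (a i * s) + b k / (b j * t)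

/-- Item `k` belongs to the candidate set given by the parameters `d 0, …, d 6`: it is one of the
items `d 0`, `d 1`, or it is at most as valuable as these, its demands are at most those of the
items `d 2`, `d 3`, and its weight per value comes before that of the pivot `d 6`
(no condition if the pivot is not an item). -/
def IsCandidate (n : ℕ) (a b v : ℕ → F) (d : ℕ → ℕ) (k : ℕ) : Prop :=
  k = d 0 ∨ k = d 1 ∨
    (v k ≤ v (d 0) ∧ v k ≤ v (d 1) ∧ a k ≤ a (d 2) ∧ b k ≤ b (d 3) ∧
      (n ≤ d 6 ∨ Precedes (fun l => weight a b (d 2) (d 3) (d 4 : F) (d 5 : F) l / v l) k (d 6)))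

open Classical in
/-- The candidate set with parameters `d`. -/
def candidate (n : ℕ) (a b v : ℕ → F) (d : ℕ → ℕ) : Finset ℕ :=
  (Finset.range n).filter (IsCandidate n a b v d)

-- Breaking ties by the index gives a linear order, so a set can be built up by adding its last item
-- repeatedly.
omit [Field F] in
lemma precedes_iff (r : ℕ → F) (k m : ℕ) :
    Precedes r k m ↔ toLex (r k, k) < toLex (r m, m) := by
  rw [Prod.Lex.toLex_lt_toLex]
  simp only [Precedes]
  constructor
  · rintro (h | ⟨h, h'⟩)
    · exact Or.inl h
    · exact h.lt_or_eq.imp id fun e => ⟨e, h'⟩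
  · exact fun h => h.imp id fun e => ⟨e.1.le, e.2⟩

end Candidates

/-! ### The greedy bound and the approximation by candidate sets -/

section Greedy

variable {F : Type} [Field F] [LinearOrder F] [IsStrictOrderedRing F]

open Classical in
/-- Either everything fits, or there is an item whose predecessors fit, but not together with it. -/
lemma exists_pivot (r w : ℕ → F) {W : F} (hW : 0 ≤ W) (E : Finset ℕ) :
    ∑ k ∈ E, w k ≤ W ∨ ∃ m ∈ E, ∑ k ∈ E.filter (Precedes r · m), w k ≤ W ∧
      W < ∑ k ∈ E.filter (Precedes r · m), w k + w m := by
  induction E using Finset.induction_on_max_value (f := fun k => toLex (r k, k)) with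
  | empty => exact Or.inl (by simpa using hW)
  | insert x E hx hmax ih =>
    have hself : ¬ Precedes r x x := by simp [precedes_iff]
    -- The new item `x` comes last, so an earlier pivot keeps its set of predecessors; without one,
    -- `x` is the pivot if the total now overflows.
    rcases ih with ih | ⟨m, hm, h1, h2⟩
    · by_cases h : ∑ k ∈ insert x E, w k ≤ W
      · exact Or.inl h
      · refine Or.inr ⟨x, Finset.mem_insert_self _ _, ?_⟩
        have e : (insert x E).filter (Precedes r · x) = E := by
          rw [Finset.filter_insert, if_neg hself, Finset.filter_eq_self]
          intro k hk
          rw [precedes_iff]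
          refine lt_of_le_of_ne (hmax k hk) fun e => hx ?_
          have : k = x := by simpa using congrArg (fun p => (ofLex p).2) e
          exact this ▸ hk
        rw [e]
        rw [Finset.sum_insert hx] at h
        exact ⟨ih, by linarith⟩
    · refine Or.inr ⟨m, Finset.mem_insert_of_mem hm, ?_⟩
      have : ¬ Precedes r x m := by
        rw [precedes_iff]
        exact not_lt.mpr (hmax m hm)
      rw [Finset.filter_insert, if_neg this]
      exact ⟨h1, h2⟩

open Classical in
/-- The greedy bound: the predecessors of the pivot, together with the pivot, are worth at least
the fraction `1 / c` of any set of weight at most `c * W`. -/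
lemma greedy_bound {w v : ℕ → F} {W c : F} {E S : Finset ℕ} {m : ℕ}
    (hv : ∀ k ∈ E, 0 < v k) (hS : S ⊆ E) (hm : m ∈ E) (hc : 1 ≤ c)
    (h1 : ∑ k ∈ E.filter (Precedes (fun l => w l / v l) · m), w k ≤ W)
    (h2 : W < ∑ k ∈ E.filter (Precedes (fun l => w l / v l) · m), w k + w m)
    (hSW : ∑ k ∈ S, w k ≤ c * W) :
    ∑ k ∈ S, v k ≤
      c * (∑ k ∈ E.filter (Precedes (fun l => w l / v l) · m), v k + v m) := by
  set r : ℕ → F := fun l => w l / v l with hr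
  set P := E.filter (Precedes r · m) with hP
  have hmP : m ∉ P := by simp [hP, precedes_iff]
  have hwr : ∀ k ∈ E, w k = r k * v k := fun k hk => by
    rw [hr]; field_simp [(hv k hk).ne']
  have hq : 0 < r m := by
    have : 0 < w m := by linarith
    exact div_pos this (hv m hm)
  set q := r m with hqdef
  -- Lagrangian argument with multiplier `q`: the reduced value `q * v k - w k` is nonnegative up to
  -- the pivot and nonpositive beyond it, so no subset of `E` exceeds `insert m P` in reduced value.
  have hQ : ∀ k ∈ insert m P, 0 ≤ q * v k - w k := by
    intro k hk
    rcases Finset.mem_insert.mp hk with rfl | hk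
    · rw [hwr k hm]; simp [hqdef]
    · obtain ⟨hkE, hk⟩ := Finset.mem_filter.mp hk
      have : r k ≤ q := hk.elim le_of_lt And.left
      rw [hwr k hkE, ← sub_mul]
      exact mul_nonneg (by linarith) (hv k hkE).le
  have hnQ : ∀ k ∈ S, k ∉ insert m P → q * v k - w k ≤ 0 := by
    intro k hk hkn
    have hkE := hS hk
    have hle : q ≤ r k := by
      by_contra hlt
      exact hkn (Finset.mem_insert_of_mem
        (Finset.mem_filter.mpr ⟨hkE, Or.inl (not_le.mp hlt)⟩))
    rw [hwr k hkE, ← sub_mul]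
    exact mul_nonpos_of_nonpos_of_nonneg (by linarith) (hv k hkE).le
  have key : ∑ k ∈ S, (q * v k - w k) ≤ ∑ k ∈ insert m P, (q * v k - w k) := by
    rw [← Finset.sum_filter_add_sum_filter_not S (· ∈ insert m P)]
    have e1 : ∑ k ∈ S.filter (· ∉ insert m P), (q * v k - w k) ≤ 0 :=
      Finset.sum_nonpos fun k hk => hnQ k (Finset.mem_filter.mp hk).1 (Finset.mem_filter.mp hk).2
    have e2 : ∑ k ∈ S.filter (· ∈ insert m P), (q * v k - w k) ≤
        ∑ k ∈ insert m P, (q * v k - w k) :=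
      Finset.sum_le_sum_of_subset_of_nonneg (fun k hk => (Finset.mem_filter.mp hk).2)
        fun k hk _ => hQ k hk
    linarith
  have hpos : 0 ≤ ∑ k ∈ insert m P, (q * v k - w k) := Finset.sum_nonneg hQ
  simp only [Finset.sum_sub_distrib, ← Finset.mul_sum, Finset.sum_insert hmP] at key hpos
  set VS := ∑ k ∈ S, v k
  set WS := ∑ k ∈ S, w k
  set VP := ∑ k ∈ P, v k
  set WP := ∑ k ∈ P, w k
  have hWpos : 0 ≤ c - 1 := by linarith
  -- After `key` and the overflow `h2`, an excess `(c - 1) * W` remains; it is paid by `h2` once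
  -- more and `hpos`.
  have : q * VS ≤ q * (c * (VP + v m)) := by
    have t1 : (c - 1) * W ≤ (c - 1) * (WP + w m) := mul_le_mul_of_nonneg_left h2.le hWpos
    have t2 : (c - 1) * (w m + WP) ≤ (c - 1) * (q * (v m + VP)) :=
      mul_le_mul_of_nonneg_left (by linarith) hWpos
    linarith
  exact le_of_mul_le_mul_left this hq

/-! ### Rounding the total demands -/

variable [Archimedean F]

/-- The sum of `a` over `S` is, up to the factor `1 + 1 / N`, the multiple `s / N` of the largest
summand `a i`. -/
lemma exists_scale {n N : ℕ} (hN : 0 < N) {a : ℕ → F} (ha : ∀ k, 0 ≤ a k)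
    {S : Finset ℕ} (hS : S ⊆ Finset.range n) (hne : S.Nonempty) :
    ∃ i ∈ S, ∃ s ≤ N * n, N ≤ s ∧ (∀ k ∈ S, a k ≤ a i) ∧
      a i * s ≤ N * ∑ k ∈ S, a k ∧ N * ∑ k ∈ S, a k ≤ a i * (s + 1) := by
  obtain ⟨i, hi, hmax⟩ := S.exists_max_image a hne
  refine ⟨i, hi, ?_⟩
  have hn : S.card ≤ n := by simpa using Finset.card_le_card hS
  have h1 : a i ≤ ∑ k ∈ S, a k := Finset.single_le_sum (fun k _ => ha k) hi
  have hup : ∑ k ∈ S, a k ≤ n * a i :=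
    (Finset.sum_le_card_nsmul S a (a i) hmax).trans (by
      rw [nsmul_eq_mul]
      exact mul_le_mul_of_nonneg_right (by exact_mod_cast hn) (ha i))
  have hn1 : 1 ≤ n := (Nat.succ_le_of_lt (Finset.card_pos.mpr hne)).trans hn
  rcases (ha i).eq_or_lt with h0 | hpos
  · have hz : ∑ k ∈ S, a k = 0 := by
      rw [← h0, mul_zero] at hup
      rw [← h0] at h1
      exact le_antisymm hup h1
    refine ⟨N, Nat.le_mul_of_pos_right _ hn1, le_rfl, hmax, ?_, ?_⟩ <;> simp [hz, ← h0]
  · have hNF : (0 : F) ≤ N := N.cast_nonneg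
    let _ := Archimedean.floorRing F
    set x : F := N * (∑ k ∈ S, a k) / a i with hx
    have hx0 : 0 ≤ x := div_nonneg (mul_nonneg hNF (h1.trans' (ha i))) hpos.le
    have hxa : a i * x = N * ∑ k ∈ S, a k := by rw [hx]; field_simp
    refine ⟨⌊x⌋₊, ?_, ?_, hmax, ?_, ?_⟩
    · have : x ≤ (N * n : ℕ) := by
        rw [hx, div_le_iff₀ hpos]; push_cast
        rw [mul_assoc]
        exact mul_le_mul_of_nonneg_left hup hNF
      exact_mod_cast (Nat.floor_le hx0).trans this
    · apply Nat.le_floor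
      rw [hx, le_div_iff₀ hpos]
      exact mul_le_mul_of_nonneg_left h1 hNF
    · rw [← hxa]
      exact mul_le_mul_of_nonneg_left (Nat.floor_le hx0) hpos.le
    · rw [← hxa]
      exact mul_le_mul_of_nonneg_left (Nat.lt_floor_add_one x).le hpos.le

-- The scaled total is at most `(s + 1) / s * (1 / N)`, and the rounding loss `(s + 1) / s` is worst
-- at `s = N`.
omit [Archimedean F] in
lemma sum_div_scale_le {N s : ℕ} (hN : 0 < N) (hs : N ≤ s) {A X : F} (hA : 0 ≤ A)
    (h : N * X ≤ A * (s + 1)) : X / (A * s) ≤ ((N + 1) / N) * (1 / N) := by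
  have hNF : (0 : F) < N := by exact_mod_cast hN
  have hsF : (0 : F) < s := by exact_mod_cast hN.trans_le hs
  have hNs : (N : F) ≤ s := by exact_mod_cast hs
  rcases hA.eq_or_lt with rfl | hA
  · simp; positivity
  · rw [div_le_iff₀ (by positivity)]
    have e : (N + 1 : F) / N * (1 / N) * (A * s) = (A * ((N + 1) * s)) / N / N := by
      field_simp
    rw [e, le_div_iff₀ hNF, le_div_iff₀ hNF]
    have : A * ((s + 1) * N) ≤ A * ((N + 1) * s) :=
      mul_le_mul_of_nonneg_left (by linarith) hA.le
    have := mul_le_mul_of_nonneg_right h hNF.le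
    linarith

-- The budget `A * s / N` underestimates `X`. If `A = 0`, the quotients are all zero by convention
-- and say nothing; then `a k ≤ A` gives the bound, which is why candidates are restricted by their
-- largest demands.
omit [Archimedean F] in
lemma sum_le_of_div_scale_le {N s : ℕ} (hN : 0 < N) (hs : N ≤ s) {a : ℕ → F} {A X : F}
    (hA : 0 ≤ A) (hX : A * s ≤ N * X) {P : Finset ℕ} (hP : ∀ k ∈ P, a k ≤ A)
    (h : ∑ k ∈ P, a k / (A * s) ≤ 1 / N) : ∑ k ∈ P, a k ≤ X := by
  have hNF : (0 : F) < N := by exact_mod_cast hN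
  have hsF : (0 : F) < s := by exact_mod_cast hN.trans_le hs
  rcases hA.eq_or_lt with rfl | hA
  · have : 0 ≤ X := by
      rw [zero_mul] at hX
      exact nonneg_of_mul_nonneg_right hX hNF
    exact (Finset.sum_nonpos hP).trans this
  · rw [← Finset.sum_div, div_le_div_iff₀ (by positivity) hNF] at h
    exact le_of_mul_le_mul_left (by linarith) hNF

/-- `exists_scale` for a possibly empty set. -/
lemma exists_scale' {n N : ℕ} (hN : 0 < N) {a : ℕ → F} (ha : ∀ k, 0 ≤ a k) (han : a n = 0)
    {S : Finset ℕ} (hS : S ⊆ Finset.range n) :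
    ∃ i ≤ n, ∃ s ≤ N * (n + 1), N ≤ s ∧ (∀ k ∈ S, a k ≤ a i) ∧
      a i * s ≤ N * ∑ k ∈ S, a k ∧ N * ∑ k ∈ S, a k ≤ a i * (s + 1) := by
  rcases S.eq_empty_or_nonempty with rfl | hne
  -- The index `n`, with demand zero, stands in for the missing largest item.
  · exact ⟨n, le_rfl, N, Nat.le_mul_of_pos_right _ n.succ_pos, le_rfl, by simp [han]⟩
  · obtain ⟨i, hi, s, hs, h⟩ := exists_scale hN ha hS hne
    exact ⟨i, (Finset.mem_range.mp (hS hi)).le, s,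
      hs.trans (Nat.mul_le_mul_left _ n.le_succ), h⟩

/-- Every set of items is matched by a candidate set whose demands are no larger and whose value
is at least the fraction `N / (2 * (N + 1))`. -/
lemma exists_candidate {n N : ℕ} (hN : 0 < N) {a b v : ℕ → F}
    (ha : ∀ k, 0 ≤ a k) (hb : ∀ k, 0 ≤ b k) (hv : ∀ k < n, 0 < v k)
    (han : a n = 0) (hbn : b n = 0) (hvn : v n = 0) {S : Finset ℕ} (hS : S ⊆ Finset.range n) :
    ∃ d : ℕ → ℕ, (∀ l, d l ≤ N * (n + 1)) ∧
      ∑ k ∈ candidate n a b v d, a k ≤ ∑ k ∈ S, a k ∧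
      ∑ k ∈ candidate n a b v d, b k ≤ ∑ k ∈ S, b k ∧
      N * ∑ k ∈ S, v k ≤ 2 * (N + 1) * ∑ k ∈ candidate n a b v d, v k := by
  classical
  have hNF : (0 : F) < N := by exact_mod_cast hN
  have hnN : n ≤ N * (n + 1) := n.le_succ.trans (Nat.le_mul_of_pos_left _ hN)
  have hv0 : ∀ k ∈ Finset.range n, 0 ≤ v k := fun k hk => (hv k (Finset.mem_range.mp hk)).le
  -- Sets of at most one item are candidates themselves: setting `d 1 = n` switches off the greedy
  -- part, because no item has value at most `v n = 0`.
  have hsmall : ∀ (d : ℕ → ℕ), (∀ l, d l ≤ N * (n + 1)) → candidate n a b v d = S →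
      ∃ d : ℕ → ℕ, (∀ l, d l ≤ N * (n + 1)) ∧
      ∑ k ∈ candidate n a b v d, a k ≤ ∑ k ∈ S, a k ∧
      ∑ k ∈ candidate n a b v d, b k ≤ ∑ k ∈ S, b k ∧
      N * ∑ k ∈ S, v k ≤ 2 * (N + 1) * ∑ k ∈ candidate n a b v d, v k := by
    intro d hd h
    refine ⟨d, hd, by rw [h], by rw [h], ?_⟩
    rw [h]
    exact mul_le_mul_of_nonneg_right (by linarith) (Finset.sum_nonneg fun k hk => hv0 k (hS hk))
  rcases S.eq_empty_or_nonempty with hS0 | hne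
  · refine hsmall (fun _ => n) (fun _ => hnN) ?_
    rw [hS0, candidate, Finset.filter_eq_empty_iff]
    intro k hk
    have hk := Finset.mem_range.mp hk
    simp [IsCandidate, hk.ne, hvn, hv k hk]
  obtain ⟨p, hp, hpmax⟩ := S.exists_max_image v hne
  have hpn := Finset.mem_range.mp (hS hp)
  rcases (S.erase p).eq_empty_or_nonempty with hS1 | hne1
  · refine hsmall (fun l => if l = 0 then p else n) (fun l => ?_) ?_
    · split_ifs <;> omega
    · have hSp : S = {p} := by rw [← Finset.insert_erase hp, hS1]; rfl
      ext k
      rw [hSp, candidate, Finset.mem_filter, Finset.mem_range, Finset.mem_singleton]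
      constructor
      · rintro ⟨hk, h⟩
        simpa [IsCandidate, hk.ne, hvn, not_le.mpr (hv k hk)] using h
      · rintro rfl
        exact ⟨hpn, Or.inl rfl⟩
  obtain ⟨q, hq, hqmax⟩ := (S.erase p).exists_max_image v hne1
  have hqS := Finset.mem_of_mem_erase hq
  have hqn := Finset.mem_range.mp (hS hqS)
  set S' := (S.erase p).erase q with hS'
  have hS'S : S' ⊆ S := (Finset.erase_subset _ _).trans (Finset.erase_subset _ _)
  have hsum : ∀ f : ℕ → F, ∑ k ∈ S, f k = f p + f q + ∑ k ∈ S', f k := fun f => by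
    rw [← Finset.add_sum_erase S f hp, ← Finset.add_sum_erase _ f hq, add_assoc]
  obtain ⟨i, hi, s, hsN, hNs, hamax, hs1, hs2⟩ := exists_scale' hN ha han (hS'S.trans hS)
  obtain ⟨j, hj, t, htN, hNt, hbmax, ht1, ht2⟩ := exists_scale' hN hb hbn (hS'S.trans hS)
  set w := weight a b i j (s : F) (t : F) with hw
  have hwa : ∀ k, 0 ≤ a k / (a i * s) := fun k =>
    div_nonneg (ha k) (mul_nonneg (ha i) s.cast_nonneg)
  have hwb : ∀ k, 0 ≤ b k / (b j * t) := fun k =>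
    div_nonneg (hb k) (mul_nonneg (hb j) t.cast_nonneg)
  set E := (Finset.range n).filter fun k =>
    k ≠ p ∧ k ≠ q ∧ v k ≤ v p ∧ v k ≤ v q ∧ a k ≤ a i ∧ b k ≤ b j with hE
  have hS'E : S' ⊆ E := fun k hk => by
    have h1 := Finset.mem_erase.mp hk
    have h2 := Finset.mem_erase.mp h1.2
    exact Finset.mem_filter.mpr ⟨hS h2.2, h2.1, h1.1, hpmax k h2.2, hqmax k h1.2,
      hamax k hk, hbmax k hk⟩
  have hEv : ∀ k ∈ E, 0 < v k := fun k hk =>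
    hv k (Finset.mem_range.mp (Finset.mem_filter.mp hk).1)
  have hwS : ∑ k ∈ S', w k ≤ (2 * (N + 1) / N) * (1 / N) := by
    have e : ∑ k ∈ S', w k = (∑ k ∈ S', a k) / (a i * s) + (∑ k ∈ S', b k) / (b j * t) := by
      rw [Finset.sum_div, Finset.sum_div, ← Finset.sum_add_distrib]; rfl
    have h1 := sum_div_scale_le hN hNs (ha i) hs2
    have h2 := sum_div_scale_le hN hNt (hb j) ht2
    rw [e]
    refine (add_le_add h1 h2).trans (le_of_eq ?_)
    ring
  have hc : (1 : F) ≤ 2 * (N + 1) / N := by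
    rw [le_div_iff₀ hNF]; linarith
  have main : ∃ m ≤ n, ∑ k ∈ E.filter (fun k => n ≤ m ∨ Precedes (fun l => w l / v l) k m), w k
        ≤ 1 / N ∧
      ∑ k ∈ S', v k ≤ 2 * (N + 1) / N * (∑ k ∈ E.filter
        (fun k => n ≤ m ∨ Precedes (fun l => w l / v l) k m), v k + v q) ∧
      ∑ k ∈ S', v k ≤ 2 * (N + 1) / N * (∑ k ∈ E.filter
        (fun k => n ≤ m ∨ Precedes (fun l => w l / v l) k m), v k + v p) := by
    rcases exists_pivot (fun l => w l / v l) w (W := 1 / N) (by positivity) E with h | ⟨m, hm, h⟩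
    · refine ⟨n, le_rfl, ?_⟩
      have e : E.filter (fun k => n ≤ n ∨ Precedes (fun l => w l / v l) k n) = E := by simp
      rw [e]
      have h1 : ∑ k ∈ S', v k ≤ ∑ k ∈ E, v k :=
        Finset.sum_le_sum_of_subset_of_nonneg hS'E fun k hk _ => (hEv k hk).le
      have h0 : 0 ≤ ∑ k ∈ E, v k := Finset.sum_nonneg fun k hk => (hEv k hk).le
      refine ⟨h, ?_, ?_⟩
      · have := mul_le_mul_of_nonneg_right hc (add_nonneg h0 (hv q hqn).le)
        linarith [hv q hqn]
      · have := mul_le_mul_of_nonneg_right hc (add_nonneg h0 (hv p hpn).le)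
        linarith [hv p hpn]
    · have hmE := Finset.mem_filter.mp hm
      have hmn := Finset.mem_range.mp hmE.1
      refine ⟨m, hmn.le, ?_⟩
      have e : E.filter (fun k => n ≤ m ∨ Precedes (fun l => w l / v l) k m) =
          E.filter (Precedes (fun l => w l / v l) · m) :=
        Finset.filter_congr fun k _ => or_iff_right (not_le.mpr hmn)
      rw [e]
      have h1 := greedy_bound hEv hS'E hm hc h.1 h.2 hwS
      exact ⟨h.1, h1.trans (by gcongr; exact hmE.2.2.2.2.1),
        h1.trans (by gcongr; exact hmE.2.2.2.1)⟩
  obtain ⟨m, hmn, hmw, hmq, hmp⟩ := main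
  set P := E.filter (fun k => n ≤ m ∨ Precedes (fun l => w l / v l) k m) with hP
  let d : ℕ → ℕ := fun l => [p, q, i, j, s, t, m].getD l 0
  have hcand : candidate n a b v d = insert p (insert q P) := by
    ext k
    simp only [candidate, IsCandidate, Finset.mem_filter, Finset.mem_insert, hP, hE,
      Finset.mem_range, d, List.getD_cons_zero, List.getD_cons_succ]
    rw [← hw]
    by_cases h1 : k = p
    · simp [h1, hpn]
    by_cases h2 : k = q
    · simp [h2, hqn]
    simp only [h1, h2, ne_eq, not_false_eq_true, true_and, false_or]
    tauto
  have hqp : p ≠ q := (Finset.mem_erase.mp hq).1.symm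
  have hqP : q ∉ P := by simp [hP, hE]
  have hpP : p ∉ insert q P := by simp [hP, hE, hqp]
  have hPa : ∑ k ∈ P, a k ≤ ∑ k ∈ S', a k :=
    sum_le_of_div_scale_le hN hNs (ha i) hs1
      (fun k hk => (Finset.mem_filter.mp (Finset.mem_filter.mp hk).1).2.2.2.2.2.1)
      ((Finset.sum_le_sum fun k _ => le_add_of_nonneg_right (hwb k)).trans hmw)
  have hPb : ∑ k ∈ P, b k ≤ ∑ k ∈ S', b k :=
    sum_le_of_div_scale_le hN hNt (hb j) ht1
      (fun k hk => (Finset.mem_filter.mp (Finset.mem_filter.mp hk).1).2.2.2.2.2.2)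
      ((Finset.sum_le_sum fun k _ => le_add_of_nonneg_left (hwa k)).trans hmw)
  refine ⟨d, fun l => ?_, ?_, ?_, ?_⟩
  · rcases l with _ | _ | _ | _ | _ | _ | _ | l <;> simp [d] <;> omega
  · rw [hcand, Finset.sum_insert hpP, Finset.sum_insert hqP, hsum a]; linarith
  · rw [hcand, Finset.sum_insert hpP, Finset.sum_insert hqP, hsum b]; linarith
  · rw [hcand, Finset.sum_insert hpP, Finset.sum_insert hqP, hsum v]
    rw [div_mul_eq_mul_div, le_div_iff₀ hNF] at hmq hmp
    have h1 := hv p hpn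
    have h2 := hv q hqn
    -- The mean of `hmq` and `hmp` charges `(N + 1) * (v p + v q)` for the pivot; with the `N * (v p
    -- + v q)` of the two items themselves this stays below `2 * (N + 1) * (v p + v q)`.
    nlinarith

end Greedy

/-! ### Reading memory after a store -/

section Update

variable {F : Type}

lemma State.updNat_nat (σ : State F) (a i x a' i' : ℕ) :
    (σ.updNat a i x).nat a' i' = if a' = a ∧ i' = i then x else σ.nat a' i' := by
  by_cases h : a' = a
  · subst h; simp [State.updNat, Function.update_apply]
  · simp [State.updNat, h]

lemma State.updFld_fld (σ : State F) (a i : ℕ) (x : F) (a' i' : ℕ) :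
    (σ.updFld a i x).fld a' i' = if a' = a ∧ i' = i then x else σ.fld a' i' := by
  by_cases h : a' = a
  · subst h; simp [State.updFld, Function.update_apply]
  · simp [State.updFld, h]

end Update

/-! ### Cost bounds -/

section Cost

variable {F : Type} [Field F]

/-- `ℓ` is equivalent to the size function `sz`, and subadditive under the field operations. -/
structure SizeMeasure (sz ℓ : F → ℕ) : Prop where
  size_le : ∀ x, sz x ≤ 2 * ℓ x
  le_size : ∀ x, ℓ x ≤ sz x + 1
  add : ∀ x y, ℓ (x + y) ≤ ℓ x + ℓ y
  sub : ∀ x y, ℓ (x - y) ≤ ℓ x + ℓ y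
  mul : ∀ x y, ℓ (x * y) ≤ ℓ x + ℓ y
  div : ∀ x y, ℓ (x / y) ≤ ℓ x + ℓ y

/-- All memory cells have size at most `B`. -/
def State.Bounded (ℓ : F → ℕ) (B : ℕ) (σ : State F) : Prop :=
  (∀ a i, Nat.size (σ.nat a i) ≤ B) ∧ ∀ a i, ℓ (σ.fld a i) ≤ B

/-- The cost of evaluating an expression in a state bounded by `B` is at most its weight times
`B + 1`. -/
def NExp.wt : NExp → ℕ
  | .lit m => 1 + Nat.size m
  | .read _ i => i.wt + 2
  | .add e f | .sub e f | .mul e f | .div e f | .mod e f => 2 * (e.wt + f.wt)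

/-- The factor 3 consists of 1 for evaluating the operands and 2 for the size of the result, by `sz
≤ 2 * ℓ`. -/
def FExp.wt (ℓ : F → ℕ) : FExp → ℕ
  | .lit q => 1 + 2 * ℓ (q : F)
  | .read _ i => i.wt + 2
  | .add e f | .sub e f | .mul e f | .div e f => 3 * (e.wt ℓ + f.wt ℓ) + 1

def Test.wt (ℓ : F → ℕ) : Test → ℕ
  | .natLe e f => e.wt + f.wt + 1
  | .fldLe e f => e.wt ℓ + f.wt ℓ + 1
  | .not b => b.wt ℓ + 1
  | .and b c => b.wt ℓ + c.wt ℓ + 1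

def Program.wt (ℓ : F → ℕ) : Program → ℕ
  | .skip => 1
  | .setNat _ i e => i.wt + e.wt + 1
  | .setFld _ i e => i.wt + e.wt ℓ + 1
  | .seq P Q => P.wt ℓ + Q.wt ℓ
  | .branch b P Q => b.wt ℓ + P.wt ℓ + Q.wt ℓ
  | .loop b P => b.wt ℓ + P.wt ℓ

lemma _root_.Nat.size_add_le (m n : ℕ) : Nat.size (m + n) ≤ Nat.size m + Nat.size n + 1 := by
  rw [Nat.size_le, pow_succ, pow_add]
  have h1 := Nat.lt_size_self m
  have h2 := Nat.lt_size_self n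
  have p1 : 1 ≤ 2 ^ Nat.size m := Nat.one_le_two_pow
  have p2 : 1 ≤ 2 ^ Nat.size n := Nat.one_le_two_pow
  nlinarith

lemma _root_.Nat.size_mul_le (m n : ℕ) : Nat.size (m * n) ≤ Nat.size m + Nat.size n := by
  rw [Nat.size_le, pow_add]
  exact Nat.mul_lt_mul'' (Nat.lt_size_self m) (Nat.lt_size_self n)

lemma _root_.Nat.size_le_self (m : ℕ) : Nat.size m ≤ m :=
  Nat.size_le.mpr Nat.lt_two_pow_self

omit [Field F] in
lemma NExp.size_eval_lt_cost (σ : State F) (e : NExp) : Nat.size (e.eval σ) + 1 ≤ e.cost σ := by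
  cases e <;> simp only [NExp.eval, NExp.cost] <;> omega

variable {sz ℓ : F → ℕ}

omit [Field F] in
lemma NExp.cost_le {B : ℕ} {σ : State F} (hσ : σ.Bounded ℓ B) (e : NExp) :
    e.cost σ ≤ e.wt * (B + 1) := by
  induction e with
  | lit m => simp only [NExp.cost, NExp.wt]; nlinarith
  | read a i ih =>
    have := hσ.1 a (i.eval σ)
    simp only [NExp.cost, NExp.wt]; nlinarith
  | add e f he hf =>
    have := Nat.size_add_le (e.eval σ) (f.eval σ)
    have := e.size_eval_lt_cost σ
    have := f.size_eval_lt_cost σ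
    simp only [NExp.cost, NExp.wt]; linarith
  | sub e f he hf =>
    have := Nat.size_le_size (Nat.sub_le (e.eval σ) (f.eval σ))
    have := e.size_eval_lt_cost σ
    have := f.size_eval_lt_cost σ
    simp only [NExp.cost, NExp.wt]; linarith
  | mul e f he hf =>
    have := Nat.size_mul_le (e.eval σ) (f.eval σ)
    have := e.size_eval_lt_cost σ
    have := f.size_eval_lt_cost σ
    simp only [NExp.cost, NExp.wt]; linarith
  | div e f he hf =>
    have := Nat.size_le_size (Nat.div_le_self (e.eval σ) (f.eval σ))
    have := e.size_eval_lt_cost σ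
    have := f.size_eval_lt_cost σ
    simp only [NExp.cost, NExp.wt]; linarith
  | mod e f he hf =>
    have := Nat.size_le_size (Nat.mod_le (e.eval σ) (f.eval σ))
    have := e.size_eval_lt_cost σ
    have := f.size_eval_lt_cost σ
    simp only [NExp.cost, NExp.wt]; linarith

/-- An operation is charged the size of its value, so the induction must also control the measure of
the values; it is `ℓ`, not `sz`, that is subadditive. -/
lemma FExp.cost_le (hℓ : SizeMeasure sz ℓ) {B : ℕ} {σ : State F} (hσ : σ.Bounded ℓ B) (e : FExp) :
    e.cost sz σ ≤ e.wt ℓ * (B + 1) ∧ ℓ (e.eval σ) ≤ e.wt ℓ * (B + 1) := by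
  induction e with
  | lit q =>
    have := hℓ.size_le (q : F)
    simp only [FExp.cost, FExp.eval, FExp.wt]
    constructor <;> nlinarith
  | read a i =>
    have h1 := hσ.2 a (i.eval σ)
    have h2 := hℓ.size_le (σ.fld a (i.eval σ))
    have h3 := i.cost_le hσ
    simp only [FExp.cost, FExp.eval, FExp.wt]
    constructor <;> nlinarith
  | add e f he hf =>
    have h1 := hℓ.add (e.eval σ) (f.eval σ)
    have h2 := hℓ.size_le (e.eval σ + f.eval σ)
    simp only [FExp.cost, FExp.eval, FExp.wt]
    constructor <;> linarith
  | sub e f he hf =>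
    have h1 := hℓ.sub (e.eval σ) (f.eval σ)
    have h2 := hℓ.size_le (e.eval σ - f.eval σ)
    simp only [FExp.cost, FExp.eval, FExp.wt]
    constructor <;> linarith
  | mul e f he hf =>
    have h1 := hℓ.mul (e.eval σ) (f.eval σ)
    have h2 := hℓ.size_le (e.eval σ * f.eval σ)
    simp only [FExp.cost, FExp.eval, FExp.wt]
    constructor <;> linarith
  | div e f he hf =>
    have h1 := hℓ.div (e.eval σ) (f.eval σ)
    have h2 := hℓ.size_le (e.eval σ / f.eval σ)
    simp only [FExp.cost, FExp.eval, FExp.wt]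
    constructor <;> linarith

lemma Test.cost_le (hℓ : SizeMeasure sz ℓ) {B : ℕ} {σ : State F} (hσ : σ.Bounded ℓ B) (b : Test) :
    b.cost sz σ ≤ b.wt ℓ * (B + 1) := by
  induction b with
  | natLe e f =>
    have h1 := e.cost_le hσ
    have h2 := f.cost_le hσ
    simp only [Test.cost, Test.wt]; linarith
  | fldLe e f =>
    have h1 := (e.cost_le hℓ hσ).1
    have h2 := (f.cost_le hℓ hσ).1
    simp only [Test.cost, Test.wt]; linarith
  | not b hb => simp only [Test.cost, Test.wt]; linarith
  | and b c hb hc => simp only [Test.cost, Test.wt]; linarith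

/-! ### Total correctness with cost -/

variable [LinearOrder F]

/-- Started in a state bounded by `B` that satisfies `Pre`, the program halts, at a cost of at most
`s * (B + 1)` times its weight, in a state bounded by `B` that satisfies `Post`. -/
def Triple (sz ℓ : F → ℕ) (B s : ℕ) (Pre : State F → Prop) (P : Program)
    (Post : State F → Prop) : Prop :=
  ∀ σ, Pre σ → σ.Bounded ℓ B →
    ∃ σ' t, Exec sz P σ σ' t ∧ t ≤ s * (P.wt ℓ * (B + 1)) ∧ Post σ' ∧ σ'.Bounded ℓ B

variable {B s : ℕ} {Pre Mid Post : State F → Prop} {P Q : Program}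

lemma Triple.skip (h : ∀ σ, Pre σ → Post σ) : Triple sz ℓ B 1 Pre .skip Post := by
  intro σ hσ hB
  refine ⟨σ, 1, .skip σ, ?_, h σ hσ, hB⟩
  simp only [Program.wt]; linarith

/-- Only the stored value has to be bounded by `B`; intermediate results are covered by the weight
of the expression. -/
lemma Triple.setNat {a : ℕ} {i e : NExp}
    (h : ∀ σ, Pre σ → Nat.size (e.eval σ) ≤ B ∧ Post (σ.updNat a (i.eval σ) (e.eval σ))) :
    Triple sz ℓ B 1 Pre (.setNat a i e) Post := by
  intro σ hσ hB
  refine ⟨_, _, .setNat a i e σ, ?_, (h σ hσ).2, ?_, hB.2⟩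
  · have h1 := i.cost_le hB
    have h2 := e.cost_le hB
    simp only [Program.wt]; linarith
  · intro a' i'
    rw [State.updNat_nat]
    split_ifs
    · exact (h σ hσ).1
    · exact hB.1 a' i'

lemma Triple.setFld (hℓ : SizeMeasure sz ℓ) {a : ℕ} {i : NExp} {e : FExp}
    (h : ∀ σ, Pre σ → ℓ (e.eval σ) ≤ B ∧ Post (σ.updFld a (i.eval σ) (e.eval σ))) :
    Triple sz ℓ B 1 Pre (.setFld a i e) Post := by
  intro σ hσ hB
  refine ⟨_, _, .setFld a i e σ, ?_, (h σ hσ).2, hB.1, ?_⟩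
  · have h1 := i.cost_le hB
    have h2 := (e.cost_le hℓ hB).1
    simp only [Program.wt]; linarith
  · intro a' i'
    rw [State.updFld_fld]
    split_ifs
    · exact (h σ hσ).1
    · exact hB.2 a' i'

lemma Triple.seq (hP : Triple sz ℓ B s Pre P Mid) (hQ : Triple sz ℓ B s Mid Q Post) :
    Triple sz ℓ B s Pre (.seq P Q) Post := by
  intro σ hσ hB
  obtain ⟨σ₁, t₁, e₁, c₁, h₁, hB₁⟩ := hP σ hσ hB
  obtain ⟨σ₂, t₂, e₂, c₂, h₂, hB₂⟩ := hQ σ₁ h₁ hB₁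
  refine ⟨σ₂, _, e₁.seq e₂, ?_, h₂, hB₂⟩
  simp only [Program.wt]; linarith

lemma Triple.mono {s' : ℕ} (hs : s ≤ s') (hP : Triple sz ℓ B s Pre P Post) :
    Triple sz ℓ B s' Pre P Post := by
  intro σ hσ hB
  obtain ⟨σ', t, e, c, h⟩ := hP σ hσ hB
  exact ⟨σ', t, e, c.trans (Nat.mul_le_mul_right _ hs), h⟩

lemma Triple.branch (hℓ : SizeMeasure sz ℓ) (hs : 1 ≤ s) {b : Test}
    (hP : Triple sz ℓ B s (fun σ => Pre σ ∧ b.Holds σ) P Post)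
    (hQ : Triple sz ℓ B s (fun σ => Pre σ ∧ ¬ b.Holds σ) Q Post) :
    Triple sz ℓ B s Pre (.branch b P Q) Post := by
  intro σ hσ hB
  have hb := b.cost_le hℓ hB
  have hb' : b.wt ℓ * (B + 1) ≤ s * (b.wt ℓ * (B + 1)) := Nat.le_mul_of_pos_left _ hs
  by_cases h : b.Holds σ
  · obtain ⟨σ', t, e, c, h'⟩ := hP σ ⟨hσ, h⟩ hB
    refine ⟨σ', _, .branchTrue h e, ?_, h'⟩
    simp only [Program.wt]
    have := Nat.zero_le (s * (Q.wt ℓ * (B + 1)))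
    linarith
  · obtain ⟨σ', t, e, c, h'⟩ := hQ σ ⟨hσ, h⟩ hB
    refine ⟨σ', _, .branchFalse h e, ?_, h'⟩
    simp only [Program.wt]
    have := Nat.zero_le (s * (P.wt ℓ * (B + 1)))
    linarith

/-- A loop with counter: the invariant `Inv k` holds before the `k`-th round, and there are `n`
rounds. -/
lemma Triple.loop (hℓ : SizeMeasure sz ℓ) (hs : 1 ≤ s) {b : Test} {n : ℕ}
    {Inv : ℕ → State F → Prop} (hb : ∀ k ≤ n, ∀ σ, Inv k σ → (b.Holds σ ↔ k < n))
    (hP : ∀ k < n, Triple sz ℓ B s (Inv k) P (Inv (k + 1))) :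
    Triple sz ℓ B (s * (n + 1)) (Inv 0) (.loop b P) (Inv n) := by
  suffices H : ∀ m k, k + m = n → ∀ σ, Inv k σ → σ.Bounded ℓ B →
      ∃ σ' t, Exec sz (.loop b P) σ σ' t ∧
        t ≤ (s * (m + 1)) * ((Program.loop b P).wt ℓ * (B + 1)) ∧ Inv n σ' ∧ σ'.Bounded ℓ B from
    H n 0 (zero_add n)
  intro m
  induction m with
  | zero =>
    rintro k rfl σ hσ hB
    refine ⟨σ, _, .loopStop fun h => absurd ((hb k le_rfl σ hσ).mp h) (lt_irrefl k), ?_, hσ, hB⟩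
    refine (b.cost_le hℓ hB).trans ?_
    simp only [Program.wt]
    have : b.wt ℓ * (B + 1) ≤ (b.wt ℓ + P.wt ℓ) * (B + 1) :=
      Nat.mul_le_mul_right _ (Nat.le_add_right _ _)
    exact this.trans (Nat.le_mul_of_pos_left _ (by positivity))
  | succ m ih =>
    intro k hk σ hσ hB
    have hkn : k < n := by omega
    obtain ⟨σ₁, t₁, e₁, c₁, h₁, hB₁⟩ := hP k hkn σ hσ hB
    obtain ⟨σ₂, t₂, e₂, c₂, h₂, hB₂⟩ := ih (k + 1) (by omega) σ₁ h₁ hB₁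
    refine ⟨σ₂, _, .loopStep ((hb k hkn.le σ hσ).mpr hkn) e₁ e₂, ?_, h₂, hB₂⟩
    have h3 := b.cost_le hℓ hB
    have hb' : b.wt ℓ * (B + 1) ≤ s * (b.wt ℓ * (B + 1)) := Nat.le_mul_of_pos_left _ hs
    simp only [Program.wt] at c₂ ⊢
    linarith

lemma Triple.conseq {Pre' Post' : State F → Prop} (hP : Triple sz ℓ B s Pre P Post)
    (h : ∀ σ, Pre' σ → Pre σ) (h' : ∀ σ, Post σ → Post' σ) : Triple sz ℓ B s Pre' P Post' := by
  intro σ hσ hB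
  obtain ⟨σ', t, e, c, hp, hB'⟩ := hP σ (h σ hσ) hB
  exact ⟨σ', t, e, c, h' σ' hp, hB'⟩

lemma Triple.exists {α : Type} {Pre : α → State F → Prop}
    (h : ∀ x, Triple sz ℓ B s (Pre x) P Post) : Triple sz ℓ B s (fun σ => ∃ x, Pre x σ) P Post :=
  fun σ ⟨x, hx⟩ hB => h x σ hx hB

end Cost

/-! ### The program -/

/-- Disjunction of tests. -/
def Test.or (b c : Test) : Test := .not (.and (.not b) (.not c))

namespace Algo

/-- Number of items. -/
def nE : NExp := .read 0 (.lit 0)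

/-- The candidate under consideration. -/
def cE : NExp := .read 3 (.lit 0)

/-- The item under consideration. -/
def kE : NExp := .read 4 (.lit 0)

/-- The best candidate so far. -/
def bestE : NExp := .read 5 (.lit 0)

/-- The largest digit. -/
def topE (N : ℕ) : NExp := .mul (.lit N) (.add nE (.lit 1))

def baseE (N : ℕ) : NExp := .add (topE N) (.lit 1)

def powE (N : ℕ) : ℕ → NExp
  | 0 => .lit 1
  | j + 1 => .mul (powE N j) (baseE N)

/-- The `j`-th digit of the candidate number. -/
def digE (N j : ℕ) : NExp := .mod (.div cE (powE N j)) (baseE N)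

def scalar (a : ℕ) : FExp := .read a (.lit 0)

/-- The machine has no conversion of natural numbers to field elements, so the scales are looked up
in field array `4`, where `castLoop` has tabulated them. -/
def weightE (N : ℕ) (k : NExp) : FExp :=
  .add (.div (.read 1 k) (.mul (.read 1 (digE N 2)) (.read 4 (digE N 4))))
    (.div (.read 2 k) (.mul (.read 2 (digE N 3)) (.read 4 (digE N 5))))

def ratioE (N : ℕ) (k : NExp) : FExp := .div (weightE N k) (.read 3 k)

def precedesT (N : ℕ) (k m : NExp) : Test :=
  .or (.not (.fldLe (ratioE N m) (ratioE N k)))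
    (.and (.fldLe (ratioE N k) (ratioE N m)) (.not (.natLe m k)))

def eqT (e f : NExp) : Test := .and (.natLe e f) (.natLe f e)

/-- Does the current item belong to the current candidate set? -/
def memT (N : ℕ) : Test :=
  .or (eqT kE (digE N 0)) (.or (eqT kE (digE N 1))
    (.and (.fldLe (.read 3 kE) (.read 3 (digE N 0)))
      (.and (.fldLe (.read 3 kE) (.read 3 (digE N 1)))
        (.and (.fldLe (.read 1 kE) (.read 1 (digE N 2)))
          (.and (.fldLe (.read 2 kE) (.read 2 (digE N 3)))
            (.or (.natLe nE (digE N 6)) (precedesT N kE (digE N 6))))))))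

/-- The magnitude is compared through squares, as there are no square roots. -/
def feasibleT : Test :=
  .and (.fldLe (scalar 5) (.read 0 (.lit 1)))
    (.and (.fldLe (scalar 6) (.read 0 (.lit 2)))
      (.fldLe (.add (.mul (scalar 5) (scalar 5)) (.mul (scalar 6) (scalar 6)))
        (.mul (scalar 0) (scalar 0))))

def ltT (e f : NExp) : Test := .not (.natLe f e)

def incr (a : ℕ) : Program := .setNat a (.lit 0) (.add (.read a (.lit 0)) (.lit 1))

/-- Fill field array `4` with the natural numbers. -/
def castLoop (N : ℕ) : Program :=
  .loop (ltT kE (topE N))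
    (.seq (.setFld 4 (.add kE (.lit 1)) (.add (.read 4 kE) (.lit 1))) (incr 4))

def addTo (a b : ℕ) : Program := .setFld a (.lit 0) (.add (scalar a) (.read b kE))

/-- Total demand and value of the current candidate set. -/
def sumLoop (N : ℕ) : Program :=
  .loop (ltT kE nE)
    (.seq (.branch (memT N) (.seq (addTo 5 1) (.seq (addTo 6 2) (addTo 7 3))) .skip) (incr 4))

/-- Try all candidates. -/
def searchLoop (N : ℕ) : Program :=
  .loop (ltT cE (powE N 7))
    (.seq (.setNat 4 (.lit 0) (.lit 0))
      (.seq (.setFld 5 (.lit 0) (.lit 0))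
        (.seq (.setFld 6 (.lit 0) (.lit 0))
          (.seq (.setFld 7 (.lit 0) (.lit 0))
            (.seq (sumLoop N)
              -- The comparison is not strict: the record starts at zero, and the first feasible
              -- candidate must be accepted even if its value is zero.
              (.seq (.branch (.and feasibleT (.fldLe (scalar 8) (scalar 7)))
                  (.seq (.setFld 8 (.lit 0) (scalar 7)) (.setNat 5 (.lit 0) cE)) .skip)
                (incr 3)))))))

/-- Write down the current candidate set. -/
def outputLoop (N : ℕ) : Program :=
  .loop (ltT kE nE)
    (.seq (.branch (memT N) (.setNat 1 kE (.lit 1)) (.setNat 1 kE (.lit 0))) (incr 4))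

def program (N : ℕ) : Program :=
  .seq (castLoop N) (.seq (searchLoop N)
    (.seq (.setNat 3 (.lit 0) bestE) (.seq (.setNat 4 (.lit 0) (.lit 0)) (outputLoop N))))

end Algo

/-! ### Its correctness -/

/-- The digits of `c` in base `M + 1`. -/
def digits (M c j : ℕ) : ℕ := c / (M + 1) ^ j % (M + 1)

lemma digits_le (M c j : ℕ) : digits M c j ≤ M :=
  Nat.le_of_lt_succ (Nat.mod_lt _ M.succ_pos)

/-- `finFunctionFinEquiv` is positional notation; its inverse extracts exactly these digits. -/
lemma exists_digits (M J : ℕ) (d : ℕ → ℕ) (hd : ∀ l, d l ≤ M) :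
    ∃ c < (M + 1) ^ J, ∀ l < J, digits M c l = d l := by
  let f : Fin J → Fin (M + 1) := fun l => ⟨d l, Nat.lt_succ_of_le (hd l)⟩
  refine ⟨finFunctionFinEquiv f, (finFunctionFinEquiv f).2, fun l hl => ?_⟩
  exact congrArg Fin.val (congrFun (finFunctionFinEquiv.symm_apply_apply f) ⟨l, hl⟩)

section Correctness

open Algo

variable {F : Type} [Field F] [LinearOrder F]

lemma Test.holds_or (σ : State F) (b c : Test) :
    (Test.or b c).Holds σ ↔ b.Holds σ ∨ c.Holds σ := by
  simp only [Test.or, Test.Holds]; tauto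

lemma candidate_congr {n : ℕ} {a b v : ℕ → F} {d d' : ℕ → ℕ} (h : ∀ l < 7, d l = d' l) :
    candidate n a b v d = candidate n a b v d' := by
  have : IsCandidate n a b v d = IsCandidate n a b v d' := by
    funext k
    simp only [IsCandidate, h 0 (by simp), h 1 (by simp), h 2 (by simp), h 3 (by simp),
      h 4 (by simp), h 5 (by simp), h 6 (by simp)]
  rw [candidate, candidate, this]

/-- The input data, as functions on the natural numbers. -/
structure Data (F : Type) where
  n : ℕ
  a : ℕ → F
  b : ℕ → F
  v : ℕ → F
  C : F
  CR : F
  CI : F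

namespace Data

variable (D : Data F) (N : ℕ)

/-- The candidate set with number `c`. -/
def cand (c : ℕ) : Finset ℕ := candidate D.n D.a D.b D.v (digits (N * (D.n + 1)) c)

def Feas (S : Finset ℕ) : Prop :=
  ∑ k ∈ S, D.a k ≤ D.CR ∧ ∑ k ∈ S, D.b k ≤ D.CI ∧
    (∑ k ∈ S, D.a k) * (∑ k ∈ S, D.a k) + (∑ k ∈ S, D.b k) * (∑ k ∈ S, D.b k) ≤ D.C * D.C

/-- The state holds the input and the natural numbers up to `L`. -/
structure Env (D : Data F) (L : ℕ) (σ : State F) : Prop where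
  n : σ.nat 0 0 = D.n
  C : σ.fld 0 0 = D.C
  CR : σ.fld 0 1 = D.CR
  CI : σ.fld 0 2 = D.CI
  a : ∀ i, σ.fld 1 i = D.a i
  b : ∀ i, σ.fld 2 i = D.b i
  v : ∀ i, σ.fld 3 i = D.v i
  cast : ∀ i ≤ L, σ.fld 4 i = i

variable {D N} {L : ℕ}

omit [LinearOrder F] in
lemma Env.updNat {σ : State F} (h : D.Env L σ) {a i x : ℕ} (ha : a ≠ 0) :
    D.Env L (σ.updNat a i x) where
  n := by rw [State.updNat_nat, if_neg fun e => ha e.1.symm, h.n]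
  C := h.C
  CR := h.CR
  CI := h.CI
  a := h.a
  b := h.b
  v := h.v
  cast := h.cast

omit [LinearOrder F] in
lemma Env.updFld {σ : State F} (h : D.Env L σ) {a i : ℕ} {x : F} (ha : 5 ≤ a) :
    D.Env L (σ.updFld a i x) where
  n := h.n
  C := by rw [State.updFld_fld, if_neg (by omega), h.C]
  CR := by rw [State.updFld_fld, if_neg (by omega), h.CR]
  CI := by rw [State.updFld_fld, if_neg (by omega), h.CI]
  a j := by rw [State.updFld_fld, if_neg (by omega), h.a]
  b j := by rw [State.updFld_fld, if_neg (by omega), h.b]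
  v j := by rw [State.updFld_fld, if_neg (by omega), h.v]
  cast j hj := by rw [State.updFld_fld, if_neg (by omega), h.cast j hj]

/-! ### Values of the expressions in the program -/

section Eval

variable {σ : State F} (hn : σ.nat 0 0 = D.n)

include hn

omit [Field F] [LinearOrder F] in
lemma eval_topE : (topE N).eval σ = N * (D.n + 1) := by
  simp [topE, nE, NExp.eval, hn]

omit [Field F] [LinearOrder F] in
lemma eval_powE (j : ℕ) : (powE N j).eval σ = (N * (D.n + 1) + 1) ^ j := by
  induction j with
  | zero => rfl
  | succ j ih => simp [powE, NExp.eval, ih, baseE, eval_topE hn, pow_succ]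

omit [Field F] [LinearOrder F] in
lemma eval_digE (j : ℕ) : (digE N j).eval σ = digits (N * (D.n + 1)) (σ.nat 3 0) j := by
  simp [digE, NExp.eval, eval_powE hn, baseE, eval_topE hn, digits, cE]

end Eval

lemma Env.holds_memT {σ : State F} (h : D.Env (N * (D.n + 1)) σ) : (memT N).Holds σ ↔
    IsCandidate D.n D.a D.b D.v (digits (N * (D.n + 1)) (σ.nat 3 0)) (σ.nat 4 0) := by
  have hc := fun j => h.cast _ (digits_le (N * (D.n + 1)) (σ.nat 3 0) j)
  have hr : ∀ k : NExp, (ratioE N k).eval σ =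
      weight D.a D.b (digits (N * (D.n + 1)) (σ.nat 3 0) 2) (digits (N * (D.n + 1)) (σ.nat 3 0) 3)
        (digits (N * (D.n + 1)) (σ.nat 3 0) 4 : F) (digits (N * (D.n + 1)) (σ.nat 3 0) 5 : F)
        (k.eval σ) / D.v (k.eval σ) := fun k => by
    simp only [ratioE, weightE, weight, FExp.eval, h.a, h.b, h.v, eval_digE h.n, hc]
  have hk : kE.eval σ = σ.nat 4 0 := rfl
  have hnE : nE.eval σ = D.n := h.n
  simp only [memT, eqT, precedesT, Test.holds_or, Test.Holds, FExp.eval, hr, hk, hnE,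
    eval_digE h.n, h.a, h.b, h.v, IsCandidate, Precedes, not_le, ← le_antisymm_iff]

/-- `B` bounds the sizes of all the numbers that the program stores. -/
structure Bounds (D : Data F) (N : ℕ) (ℓ : F → ℕ) (B : ℕ) : Prop where
  n : D.n ≤ B
  pow : (N * (D.n + 1) + 1) ^ 7 ≤ B
  cast : ∀ i ≤ N * (D.n + 1), ℓ (i : F) ≤ B
  a : ∀ S ⊆ Finset.range D.n, ℓ (∑ k ∈ S, D.a k) ≤ B
  b : ∀ S ⊆ Finset.range D.n, ℓ (∑ k ∈ S, D.b k) ≤ B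
  v : ∀ S ⊆ Finset.range D.n, ℓ (∑ k ∈ S, D.v k) ≤ B

variable {sz ℓ : F → ℕ} {B : ℕ}

-- `B` bounds the counters by value and not just by bit length; this is crude but still polynomial.
omit [LinearOrder F] in
lemma Bounds.size_le (hB : D.Bounds N ℓ B) {x : ℕ} (hx : x ≤ D.n) : Nat.size x ≤ B :=
  (Nat.size_le_self x).trans (hx.trans hB.n)

omit [LinearOrder F] in
lemma Bounds.size_le' (hB : D.Bounds N ℓ B) {x : ℕ} (hx : x ≤ (N * (D.n + 1) + 1) ^ 7) :
    Nat.size x ≤ B :=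
  (Nat.size_le_self x).trans (hx.trans hB.pow)

omit [LinearOrder F] in
lemma Bounds.zero (hB : D.Bounds N ℓ B) : ℓ 0 ≤ B := by
  simpa using hB.cast 0 (Nat.zero_le _)

/-- The state while the natural numbers are stored, up to `k` so far. -/
structure CastInv (D : Data F) (k : ℕ) (σ : State F) : Prop where
  env : D.Env k σ
  counter : σ.nat 3 0 = 0
  item : σ.nat 4 0 = k
  best : σ.nat 5 0 = 0
  value : σ.fld 8 0 = 0

lemma castLoop_triple (hℓ : SizeMeasure sz ℓ) (hB : D.Bounds N ℓ B) :
    Triple sz ℓ B (N * (D.n + 1) + 1) (D.CastInv 0) (castLoop N)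
      (D.CastInv (N * (D.n + 1))) := by
  have hM : N * (D.n + 1) ≤ (N * (D.n + 1) + 1) ^ 7 :=
    (Nat.le_succ _).trans (Nat.le_self_pow (by norm_num) _)
  have := Triple.loop (sz := sz) (B := B) (P := .seq (.setFld 4 (.add kE (.lit 1))
      (.add (.read 4 kE) (.lit 1))) (incr 4)) hℓ le_rfl (b := ltT kE (topE N))
    (n := N * (D.n + 1)) (Inv := D.CastInv) ?_ ?_
  · rwa [one_mul] at this
  · rintro k - σ h
    simp [ltT, Test.Holds, eval_topE h.env.n, kE, NExp.eval, h.item]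
  · intro k hk
    refine Triple.seq (Mid := fun σ => D.Env (k + 1) σ ∧ σ.nat 3 0 = 0 ∧ σ.nat 4 0 = k ∧
      σ.nat 5 0 = 0 ∧ σ.fld 8 0 = 0) ?_ ?_
    · refine Triple.setFld hℓ fun σ ⟨h, h3, hkσ, h5, h8⟩ => ?_
      have e : (FExp.add (.read 4 kE) (.lit 1)).eval σ = ((k + 1 : ℕ) : F) := by
        simp [FExp.eval, kE, NExp.eval, hkσ, h.cast k le_rfl]
      have e' : (NExp.add kE (.lit 1)).eval σ = k + 1 := by simp [kE, NExp.eval, hkσ]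
      rw [e, e']
      refine ⟨hB.cast _ hk, ⟨?_, h3, hkσ, h5, h8⟩⟩
      refine ⟨h.n, ?_, ?_, ?_, fun i => ?_, fun i => ?_, fun i => ?_, fun i hi => ?_⟩ <;>
        rw [State.updFld_fld]
      · exact h.C
      · exact h.CR
      · exact h.CI
      · exact h.a i
      · exact h.b i
      · exact h.v i
      · split_ifs with hi'
        · rw [hi'.2]
        · exact h.cast i (by omega)
    · refine Triple.setNat fun σ ⟨h, h3, hkσ, h5, h8⟩ => ?_
      have e : (NExp.add (.read 4 (.lit 0)) (.lit 1)).eval σ = k + 1 := by simp [NExp.eval, hkσ]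
      rw [e]
      exact ⟨hB.size_le' (hM.trans' hk), h.updNat (by norm_num), h3,
        by simp [State.updNat_nat, NExp.eval], h5, h8⟩

open Classical in
/-- The part of the candidate set with number `c` among the first `k` items. -/
def part (D : Data F) (N c k : ℕ) : Finset ℕ :=
  (Finset.range k).filter fun l => IsCandidate D.n D.a D.b D.v (digits (N * (D.n + 1)) c) l

open Classical in
lemma part_subset {c k : ℕ} (hk : k ≤ D.n) : D.part N c k ⊆ Finset.range D.n :=
  (Finset.filter_subset _ _).trans (Finset.range_mono hk)

open Classical in
lemma sum_part_succ (f : ℕ → F) (c k : ℕ) :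
    ∑ l ∈ D.part N c (k + 1), f l = ∑ l ∈ D.part N c k, f l +
      if IsCandidate D.n D.a D.b D.v (digits (N * (D.n + 1)) c) k then f k else 0 := by
  rw [part, part, Finset.range_add_one, Finset.filter_insert]
  split_ifs
  · rw [Finset.sum_insert (by simp), add_comm]
  · rw [add_zero]

/-- The state during the summation for the candidate set with number `c`: the item `k` comes
next. -/
structure SumInv (D : Data F) (N c : ℕ) (J : ℕ → F → Prop) (k : ℕ) (x y z : F) (σ : State F) :
    Prop where
  env : D.Env (N * (D.n + 1)) σ
  counter : σ.nat 3 0 = c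
  best : J (σ.nat 5 0) (σ.fld 8 0)
  item : σ.nat 4 0 = k
  x : σ.fld 5 0 = x
  y : σ.fld 6 0 = y
  z : σ.fld 7 0 = z

/-- `J` is a frame condition: what is known about the record passes through the summation unchanged.
-/
lemma sumLoop_triple (hℓ : SizeMeasure sz ℓ) (hB : D.Bounds N ℓ B) (c : ℕ) (J : ℕ → F → Prop) :
    Triple sz ℓ B (D.n + 1) (D.SumInv N c J 0 0 0 0) (sumLoop N)
      (D.SumInv N c J D.n (∑ l ∈ D.cand N c, D.a l) (∑ l ∈ D.cand N c, D.b l)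
        (∑ l ∈ D.cand N c, D.v l)) := by
  classical
  let SA := fun k => ∑ l ∈ D.part N c k, D.a l
  let SB := fun k => ∑ l ∈ D.part N c k, D.b l
  let SV := fun k => ∑ l ∈ D.part N c k, D.v l
  have := Triple.loop (sz := sz) (B := B) (P := .seq (.branch (memT N)
      (.seq (addTo 5 1) (.seq (addTo 6 2) (addTo 7 3))) .skip) (incr 4)) hℓ le_rfl
    (b := ltT kE nE) (n := D.n) (Inv := fun k => D.SumInv N c J k (SA k) (SB k) (SV k)) ?_ ?_
  · rw [one_mul] at this
    exact this.conseq (fun σ h => by simpa [SA, SB, SV, part] using h) (fun σ h => h)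
  · rintro k - σ h
    simp [ltT, Test.Holds, kE, nE, NExp.eval, h.item, h.env.n]
  · intro k hk
    have hS := D.part_subset (N := N) (c := c) (Nat.succ_le_of_lt hk)
    refine Triple.seq (Mid := D.SumInv N c J k (SA (k + 1)) (SB (k + 1)) (SV (k + 1))) ?_ ?_
    · refine Triple.branch hℓ le_rfl ?_ ?_
      -- Under the invariant the test is equivalent to `hc`, so the intermediate assertions can be
      -- fixed in advance; if `hc` fails, this branch is unreachable.
      · by_cases hc : IsCandidate D.n D.a D.b D.v (digits (N * (D.n + 1)) c) k
        · have ha : SA (k + 1) = SA k + D.a k := by simp only [SA, sum_part_succ, if_pos hc]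
          have hb : SB (k + 1) = SB k + D.b k := by simp only [SB, sum_part_succ, if_pos hc]
          have hv : SV (k + 1) = SV k + D.v k := by simp only [SV, sum_part_succ, if_pos hc]
          refine Triple.seq (Mid := D.SumInv N c J k (SA (k + 1)) (SB k) (SV k)) ?_
            (Triple.seq (Mid := D.SumInv N c J k (SA (k + 1)) (SB (k + 1)) (SV k)) ?_ ?_)
          · refine Triple.setFld hℓ fun σ ⟨h, _⟩ => ?_
            have e : (FExp.add (scalar 5) (.read 1 kE)).eval σ = SA (k + 1) := by
              simp [FExp.eval, scalar, kE, NExp.eval, h.item, h.x, h.env.a, ha]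
            rw [e]
            exact ⟨hB.a _ hS, h.env.updFld (by norm_num), h.counter, h.best, h.item,
              by simp [State.updFld_fld, NExp.eval], h.y, h.z⟩
          · refine Triple.setFld hℓ fun σ h => ?_
            have e : (FExp.add (scalar 6) (.read 2 kE)).eval σ = SB (k + 1) := by
              simp [FExp.eval, scalar, kE, NExp.eval, h.item, h.y, h.env.b, hb]
            rw [e]
            exact ⟨hB.b _ hS, h.env.updFld (by norm_num), h.counter, h.best, h.item, h.x,
              by simp [State.updFld_fld, NExp.eval], h.z⟩
          · refine Triple.setFld hℓ fun σ h => ?_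
            have e : (FExp.add (scalar 7) (.read 3 kE)).eval σ = SV (k + 1) := by
              simp [FExp.eval, scalar, kE, NExp.eval, h.item, h.z, h.env.v, hv]
            rw [e]
            exact ⟨hB.v _ hS, h.env.updFld (by norm_num), h.counter, h.best, h.item, h.x, h.y,
              by simp [State.updFld_fld, NExp.eval]⟩
        · rintro σ ⟨h, hm⟩
          rw [h.env.holds_memT, h.counter, h.item] at hm
          exact absurd hm hc
      · refine Triple.skip fun σ ⟨h, hm⟩ => ?_
        rw [h.env.holds_memT, h.counter, h.item] at hm
        simpa only [SA, SB, SV, sum_part_succ, if_neg hm, add_zero] using h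
    · refine Triple.setNat fun σ h => ?_
      have e : (NExp.add (.read 4 (.lit 0)) (.lit 1)).eval σ = k + 1 := by simp [NExp.eval, h.item]
      rw [e]
      exact ⟨hB.size_le hk, h.env.updNat (by norm_num), h.counter, h.best,
        by simp [State.updNat_nat, NExp.eval], h.x, h.y, h.z⟩

/-- After the candidates below `c`: `x` is the largest value of a feasible candidate set so far,
attained by number `m`, or there was none and `x` is zero. -/
structure Best (D : Data F) (N c m : ℕ) (x : F) : Prop where
  lt : m < (N * (D.n + 1) + 1) ^ 7
  ge : ∀ c' < c, D.Feas (D.cand N c') → ∑ k ∈ D.cand N c', D.v k ≤ x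
  attained : (x = 0 ∧ ∀ c' < c, ¬ D.Feas (D.cand N c')) ∨
    (D.Feas (D.cand N m) ∧ ∑ k ∈ D.cand N m, D.v k = x)

lemma Best.update {c m : ℕ} {x : F} (h : D.Best N c m x) (hc : c < (N * (D.n + 1) + 1) ^ 7)
    (hF : D.Feas (D.cand N c)) (hx : x ≤ ∑ k ∈ D.cand N c, D.v k) :
    D.Best N (c + 1) c (∑ k ∈ D.cand N c, D.v k) where
  lt := hc
  ge c' hc' hF' := by
    rcases Nat.lt_succ_iff_lt_or_eq.mp hc' with h' | rfl
    · exact (h.ge c' h' hF').trans hx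
    · exact le_rfl
  attained := Or.inr ⟨hF, rfl⟩

/-- As long as nothing feasible has been seen, `x` is zero, so a rejected candidate of nonnegative
value cannot be feasible. -/
lemma Best.keep {c m : ℕ} {x : F} (h : D.Best N c m x) (hv : 0 ≤ ∑ k ∈ D.cand N c, D.v k)
    (hn : ¬ (D.Feas (D.cand N c) ∧ x ≤ ∑ k ∈ D.cand N c, D.v k)) : D.Best N (c + 1) m x where
  lt := h.lt
  ge c' hc' hF' := by
    rcases Nat.lt_succ_iff_lt_or_eq.mp hc' with h' | rfl
    · exact h.ge c' h' hF'
    · exact (not_le.mp fun hx => hn ⟨hF', hx⟩).le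
  attained := h.attained.imp (fun ⟨hx, hF⟩ => ⟨hx, fun c' hc' hF' => by
    rcases Nat.lt_succ_iff_lt_or_eq.mp hc' with h' | rfl
    · exact hF c' h' hF'
    · exact hn ⟨hF', hx.trans_le hv⟩⟩) id

/-- The state during the search: the candidate set with number `c` comes next. -/
structure SearchInv (D : Data F) (N c : ℕ) (σ : State F) : Prop where
  env : D.Env (N * (D.n + 1)) σ
  counter : σ.nat 3 0 = c
  best : D.Best N c (σ.nat 5 0) (σ.fld 8 0)

omit [LinearOrder F] in
lemma eval_lit_zero (σ : State F) : (FExp.lit 0).eval σ = 0 := by simp [FExp.eval]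

lemma cand_subset (c : ℕ) : D.cand N c ⊆ Finset.range D.n := D.part_subset le_rfl

lemma searchLoop_triple (hℓ : SizeMeasure sz ℓ) (hB : D.Bounds N ℓ B)
    (hv : ∀ S ⊆ Finset.range D.n, 0 ≤ ∑ k ∈ S, D.v k) :
    Triple sz ℓ B ((D.n + 1) * ((N * (D.n + 1) + 1) ^ 7 + 1)) (D.SearchInv N 0) (searchLoop N)
      (D.SearchInv N ((N * (D.n + 1) + 1) ^ 7)) := by
  have h1 : 1 ≤ D.n + 1 := Nat.succ_pos _
  refine Triple.loop hℓ h1 ?_ ?_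
  · intro c hc σ h
    simp [ltT, Test.Holds, cE, NExp.eval, eval_powE h.env.n, h.counter]
  · intro c hc
    let J : ℕ → F → Prop := D.Best N c
    let xs := ∑ l ∈ D.cand N c, D.a l
    let ys := ∑ l ∈ D.cand N c, D.b l
    let zs := ∑ l ∈ D.cand N c, D.v l
    refine Triple.seq (Mid := fun σ => D.SearchInv N c σ ∧ σ.nat 4 0 = 0) ?_ <|
      Triple.seq (Mid := fun σ => D.SearchInv N c σ ∧ σ.nat 4 0 = 0 ∧ σ.fld 5 0 = 0) ?_ <|
      Triple.seq (Mid := fun σ => D.SearchInv N c σ ∧ σ.nat 4 0 = 0 ∧ σ.fld 5 0 = 0 ∧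
        σ.fld 6 0 = 0) ?_ <|
      Triple.seq (Mid := D.SumInv N c J 0 0 0 0) ?_ <|
      Triple.seq (Mid := D.SumInv N c J D.n xs ys zs) (sumLoop_triple hℓ hB c J) <|
      Triple.seq (Mid := fun σ => D.Env (N * (D.n + 1)) σ ∧ σ.nat 3 0 = c ∧
        D.Best N (c + 1) (σ.nat 5 0) (σ.fld 8 0)) ?_ ?_
    · refine (Triple.setNat fun σ h => ⟨hB.size_le (Nat.zero_le _), ?_⟩).mono h1
      exact ⟨⟨h.env.updNat (by norm_num), h.counter, h.best⟩, by simp [State.updNat_nat, NExp.eval]⟩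
    · refine (Triple.setFld hℓ fun σ ⟨h, hk⟩ => ?_).mono h1
      rw [eval_lit_zero]
      exact ⟨hB.zero, ⟨h.env.updFld (by norm_num), h.counter, h.best⟩, hk,
        by simp [State.updFld_fld, NExp.eval]⟩
    · refine (Triple.setFld hℓ fun σ ⟨h, hk, hx⟩ => ?_).mono h1
      rw [eval_lit_zero]
      exact ⟨hB.zero, ⟨h.env.updFld (by norm_num), h.counter, h.best⟩, hk, hx,
        by simp [State.updFld_fld, NExp.eval]⟩
    · refine (Triple.setFld hℓ fun σ ⟨h, hk, hx, hy⟩ => ?_).mono h1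
      rw [eval_lit_zero]
      exact ⟨hB.zero, h.env.updFld (by norm_num), h.counter, h.best, hk, hx, hy,
        by simp [State.updFld_fld, NExp.eval]⟩
    · have hT : ∀ σ, D.SumInv N c J D.n xs ys zs σ →
          ((feasibleT.and (.fldLe (scalar 8) (scalar 7))).Holds σ ↔
            D.Feas (D.cand N c) ∧ σ.fld 8 0 ≤ zs) := fun σ h => by
        simp only [feasibleT, scalar, Test.Holds, FExp.eval, NExp.eval, h.x, h.y, h.z, h.env.C,
          h.env.CR, h.env.CI, Feas, xs, ys]
      refine Triple.branch hℓ h1 ?_ ?_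
      · refine Triple.mono h1 (Triple.seq (Mid := fun σ => D.Env (N * (D.n + 1)) σ ∧
          σ.nat 3 0 = c ∧ D.Best N (c + 1) c (σ.fld 8 0)) ?_ ?_)
        · refine Triple.setFld hℓ fun σ ⟨h, hb⟩ => ?_
          obtain ⟨hF, hle⟩ := (hT σ h).mp hb
          have e : (scalar 7).eval σ = zs := h.z
          rw [e]
          refine ⟨hB.v _ (cand_subset c), h.env.updFld (by norm_num), h.counter, ?_⟩
          rw [State.updFld_fld, if_pos ⟨rfl, rfl⟩]
          exact h.best.update hc hF hle
        · refine Triple.setNat fun σ ⟨h, hcσ, hb⟩ => ?_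
          have e : cE.eval σ = c := hcσ
          rw [e]
          refine ⟨hB.size_le' hc.le, h.updNat (by norm_num), hcσ, ?_⟩
          rw [State.updNat_nat, if_pos ⟨rfl, rfl⟩]
          exact hb
      · refine (Triple.skip fun σ ⟨h, hb⟩ => ?_).mono h1
        rw [hT σ h] at hb
        exact ⟨h.env, h.counter, h.best.keep (hv _ (cand_subset c)) hb⟩
    · refine (Triple.setNat fun σ ⟨h, hcσ, hb⟩ => ?_).mono h1
      have e : (NExp.add (.read 3 (.lit 0)) (.lit 1)).eval σ = c + 1 := by simp [NExp.eval, hcσ]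
      rw [e]
      exact ⟨hB.size_le' hc, h.updNat (by norm_num), by simp [State.updNat_nat, NExp.eval], hb⟩

/-- The state while the candidate set with number `c` is written down. -/
structure OutputInv (D : Data F) (N c k : ℕ) (σ : State F) : Prop where
  env : D.Env (N * (D.n + 1)) σ
  counter : σ.nat 3 0 = c
  item : σ.nat 4 0 = k
  out : ∀ l < k, σ.nat 1 l = 1 ↔ l ∈ D.part N c k

lemma mem_part_succ {c k l : ℕ} (hl : l < k) :
    l ∈ D.part N c (k + 1) ↔ l ∈ D.part N c k := by
  simp [part, hl, hl.trans k.lt_succ_self]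

lemma outputLoop_triple (hℓ : SizeMeasure sz ℓ) (hB : D.Bounds N ℓ B) (c : ℕ) :
    Triple sz ℓ B (D.n + 1) (D.OutputInv N c 0) (outputLoop N) (D.OutputInv N c D.n) := by
  have hone : Nat.size 1 ≤ B :=
    hB.size_le' (Nat.one_le_pow _ _ (Nat.succ_pos _))
  have := Triple.loop (sz := sz) (B := B) (P := .seq (.branch (memT N) (.setNat 1 kE (.lit 1))
      (.setNat 1 kE (.lit 0))) (incr 4)) hℓ le_rfl
    (b := ltT kE nE) (n := D.n) (Inv := D.OutputInv N c) ?_ ?_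
  · rwa [one_mul] at this
  · rintro k - σ h
    simp [ltT, Test.Holds, kE, nE, NExp.eval, h.item, h.env.n]
  · intro k hk
    have hstep : ∀ σ x, D.OutputInv N c k σ → (x = 1 ↔ k ∈ D.part N c (k + 1)) →
        D.Env (N * (D.n + 1)) (σ.updNat 1 (kE.eval σ) x) ∧
          (σ.updNat 1 (kE.eval σ) x).nat 3 0 = c ∧ (σ.updNat 1 (kE.eval σ) x).nat 4 0 = k ∧
          ∀ l < k + 1, (σ.updNat 1 (kE.eval σ) x).nat 1 l = 1 ↔ l ∈ D.part N c (k + 1) := by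
      intro σ x h hx
      refine ⟨h.env.updNat (by norm_num), h.counter, h.item, fun l hl => ?_⟩
      have e : kE.eval σ = k := h.item
      rw [State.updNat_nat, e]
      rcases Nat.lt_succ_iff_lt_or_eq.mp hl with hl | rfl
      · rw [if_neg (by omega), h.out l hl, mem_part_succ hl]
      · rw [if_pos ⟨rfl, rfl⟩, hx]
    have hmem : ∀ σ, D.OutputInv N c k σ → ((memT N).Holds σ ↔ k ∈ D.part N c (k + 1)) :=
      fun σ h => by
        rw [h.env.holds_memT, h.counter, h.item]
        simp [part]
    refine Triple.seq (Mid := fun σ => D.Env (N * (D.n + 1)) σ ∧ σ.nat 3 0 = c ∧ σ.nat 4 0 = k ∧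
      ∀ l < k + 1, σ.nat 1 l = 1 ↔ l ∈ D.part N c (k + 1)) ?_ ?_
    · refine Triple.branch hℓ le_rfl ?_ ?_
      · refine Triple.setNat fun σ ⟨h, hm⟩ => ⟨hone, hstep σ 1 h ?_⟩
        simpa using (hmem σ h).mp hm
      · refine Triple.setNat fun σ ⟨h, hm⟩ => ⟨hB.size_le (Nat.zero_le _), hstep σ 0 h ?_⟩
        rw [hmem σ h] at hm
        simpa using hm
    · refine Triple.setNat fun σ ⟨h, hc, hkσ, hout⟩ => ?_
      have e : (NExp.add (.read 4 (.lit 0)) (.lit 1)).eval σ = k + 1 := by simp [NExp.eval, hkσ]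
      rw [e]
      exact ⟨hB.size_le hk, h.updNat (by norm_num), hc, by simp [State.updNat_nat, NExp.eval],
        hout⟩

/-- The program computes the candidate set of largest value among the feasible ones. -/
theorem program_triple (hℓ : SizeMeasure sz ℓ) (hB : D.Bounds N ℓ B)
    (hv : ∀ S ⊆ Finset.range D.n, 0 ≤ ∑ k ∈ S, D.v k) :
    Triple sz ℓ B ((D.n + 1) * ((N * (D.n + 1) + 1) ^ 7 + 1))
      (fun σ => D.Env 0 σ ∧ (∀ a ≠ 0, ∀ i, σ.nat a i = 0) ∧ σ.fld 8 0 = 0) (program N)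
      (fun σ => ∃ m x, D.Best N ((N * (D.n + 1) + 1) ^ 7) m x ∧
        ∀ l < D.n, σ.nat 1 l = 1 ↔ l ∈ D.cand N m) := by
  have hpos : 0 < (N * (D.n + 1) + 1) ^ 7 := Nat.pow_pos (Nat.succ_pos _)
  have hle : N * (D.n + 1) + 1 ≤ (N * (D.n + 1) + 1) ^ 7 := Nat.le_self_pow (by norm_num) _
  have hs : 1 ≤ (D.n + 1) * ((N * (D.n + 1) + 1) ^ 7 + 1) := Nat.mul_pos (Nat.succ_pos _) (Nat.succ_pos _)
  refine Triple.seq (Mid := D.SearchInv N 0) ?_ <|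
    Triple.seq (searchLoop_triple hℓ hB hv) <|
    Triple.seq (Mid := fun σ => ∃ p : ℕ × F, D.Best N ((N * (D.n + 1) + 1) ^ 7) p.1 p.2 ∧
      D.Env (N * (D.n + 1)) σ ∧ σ.nat 3 0 = p.1) ?_ <|
    Triple.seq (Mid := fun σ => ∃ p : ℕ × F, D.Best N ((N * (D.n + 1) + 1) ^ 7) p.1 p.2 ∧
      D.OutputInv N p.1 0 σ) ?_ ?_
  · refine (Triple.mono (hle.trans ?_) (castLoop_triple hℓ hB)).conseq (fun σ h => ?_)
      fun σ h => ⟨h.env, h.counter, ?_⟩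
    · exact (Nat.le_succ _).trans (Nat.le_mul_of_pos_left _ D.n.succ_pos)
    · exact ⟨h.1, h.2.1 3 (by norm_num) 0, h.2.1 4 (by norm_num) 0, h.2.1 5 (by norm_num) 0, h.2.2⟩
    · rw [h.best, h.value]
      exact ⟨hpos, fun c hc => absurd hc c.not_lt_zero,
        Or.inl ⟨rfl, fun c hc => absurd hc c.not_lt_zero⟩⟩
  · refine (Triple.setNat fun σ h => ?_).mono hs
    have e : bestE.eval σ = σ.nat 5 0 := rfl
    rw [e]
    exact ⟨hB.size_le' h.best.lt.le, (σ.nat 5 0, σ.fld 8 0), h.best, h.env.updNat (by norm_num),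
      by simp [State.updNat_nat, NExp.eval]⟩
  · refine (Triple.setNat fun σ ⟨p, hp, h, hc⟩ => ⟨hB.size_le (Nat.zero_le _), p, hp, ?_⟩).mono hs
    exact ⟨h.updNat (by norm_num), hc, by simp [State.updNat_nat, NExp.eval],
      fun l hl => absurd hl l.not_lt_zero⟩
  · refine Triple.exists fun p => ?_
    rintro σ ⟨hp, h⟩ hσ
    obtain ⟨σ', t, e, ht, h', hσ'⟩ := outputLoop_triple hℓ hB p.1 σ h hσ
    refine ⟨σ', t, e, ht.trans (Nat.mul_le_mul_right _ (Nat.le_mul_of_pos_right _ (by positivity))),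
      ⟨p.1, p.2, hp, h'.out⟩, hσ'⟩

end Data

end Correctness

/-! ### Size measures on the rational and the real numbers -/

/-- Reduction to lowest terms only shrinks numerator and denominator, so sizes may be estimated on
unreduced fractions. -/
lemma natAbs_num_add_den_le (a : ℤ) {b : ℕ} (hb : b ≠ 0) :
    ((a : ℚ) / b).num.natAbs + ((a : ℚ) / b).den ≤ a.natAbs + b := by
  have hbz : (b : ℤ) ≠ 0 := by exact_mod_cast hb
  have e : (a : ℚ) / b = Rat.divInt a b := by rw [Rat.divInt_eq_div]; simp
  rw [e]
  have h2 : (Rat.divInt a b).den ≤ b :=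
    Nat.le_of_dvd (Nat.pos_of_ne_zero hb) (by exact_mod_cast Rat.den_dvd a b)
  refine add_le_add ?_ h2
  by_cases ha : a = 0
  · simp [ha]
  · exact Nat.le_of_dvd (Int.natAbs_pos.mpr ha) (Int.natAbs_dvd_natAbs.mpr (Rat.num_dvd a hbz))

/-- The number of bits of the sum of numerator and denominator. -/
def ratMeasure (q : ℚ) : ℕ := Nat.size (q.num.natAbs + q.den)

lemma ratMeasure_le {x y : ℚ} (a : ℤ) {b : ℕ} (hb : b ≠ 0)
    (h : a.natAbs + b ≤ (x.num.natAbs + x.den) * (y.num.natAbs + y.den)) :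
    ratMeasure ((a : ℚ) / b) ≤ ratMeasure x + ratMeasure y :=
  (Nat.size_le_size ((natAbs_num_add_den_le a hb).trans h)).trans (Nat.size_mul_le _ _)

/-- For fractions a/b and c/d, the product (|a| + b)(|c| + d) contains all four cross terms. It
therefore dominates numerator plus denominator of the sum, difference, product and quotient, and
taking bit lengths gives subadditivity without an additive constant. -/
lemma sizeMeasure_rat : SizeMeasure ratBits ratMeasure where
  size_le q := by
    have h1 := Nat.size_le_size (Nat.le_add_right q.num.natAbs q.den)
    have h2 := Nat.size_le_size (Nat.le_add_left q.den q.num.natAbs)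
    simp only [ratBits, ratMeasure]; omega
  le_size q := Nat.size_add_le _ _
  add x y := by
    have e : x + y = ((x.num * y.den + y.num * x.den : ℤ) : ℚ) / (x.den * y.den : ℕ) := by
      conv_lhs => rw [← Rat.num_div_den x, ← Rat.num_div_den y]
      have := x.den_nz
      have := y.den_nz
      push_cast
      field_simp
    rw [e]
    refine ratMeasure_le _ (mul_ne_zero x.den_nz y.den_nz) ?_
    have h := Int.natAbs_add_le (x.num * y.den) (y.num * x.den)
    simp only [Int.natAbs_mul, Int.natAbs_natCast] at h
    nlinarith [Nat.zero_le (x.num.natAbs * y.num.natAbs)]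
  sub x y := by
    have e : x - y = ((x.num * y.den - y.num * x.den : ℤ) : ℚ) / (x.den * y.den : ℕ) := by
      conv_lhs => rw [← Rat.num_div_den x, ← Rat.num_div_den y]
      have := x.den_nz
      have := y.den_nz
      push_cast
      field_simp
    rw [e]
    refine ratMeasure_le _ (mul_ne_zero x.den_nz y.den_nz) ?_
    have h := Int.natAbs_sub_le (x.num * y.den) (y.num * x.den)
    simp only [Int.natAbs_mul, Int.natAbs_natCast] at h
    nlinarith [Nat.zero_le (x.num.natAbs * y.num.natAbs)]
  mul x y := by
    have e : x * y = ((x.num * y.num : ℤ) : ℚ) / (x.den * y.den : ℕ) := by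
      conv_lhs => rw [← Rat.num_div_den x, ← Rat.num_div_den y]
      push_cast
      rw [div_mul_div_comm]
    rw [e]
    refine ratMeasure_le _ (mul_ne_zero x.den_nz y.den_nz) ?_
    rw [Int.natAbs_mul]
    nlinarith [Nat.zero_le (x.num.natAbs * y.den), Nat.zero_le (x.den * y.num.natAbs)]
  div x y := by
    by_cases hy : y = 0
    · subst hy
      rw [div_zero]
      refine le_trans ?_ (Nat.le_add_left _ _)
      rfl
    have hy' : y.num.natAbs ≠ 0 := by simpa using hy
    -- The sign of the divisor moves to the numerator, so that the denominator is a natural number.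
    have e : x / y = ((x.num * y.den * y.num.sign : ℤ) : ℚ) / (x.den * y.num.natAbs : ℕ) := by
      conv_lhs => rw [← Rat.num_div_den x, ← Rat.num_div_den y]
      have h1 := x.den_nz
      have h2 := y.den_nz
      have h3 : (y.num : ℚ) ≠ 0 := by exact_mod_cast Rat.num_ne_zero.mpr hy
      have h4 : ((y.num.natAbs : ℕ) : ℚ) = y.num.sign * y.num := by
        rw [← Int.cast_natCast, ← Int.sign_mul_self_eq_natAbs, Int.cast_mul]
      have h5 : (y.num.sign : ℚ) ≠ 0 := by
        have : y.num.sign ≠ 0 := by simpa using hy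
        exact_mod_cast this
      rw [Nat.cast_mul, h4]
      push_cast
      field_simp
    rw [e]
    refine ratMeasure_le _ (mul_ne_zero x.den_nz hy') ?_
    rw [Int.natAbs_mul, Int.natAbs_mul, Int.natAbs_sign_of_ne_zero (Rat.num_ne_zero.mpr hy)]
    simp only [Int.natAbs_natCast, mul_one]
    nlinarith [Nat.zero_le (x.num.natAbs * y.num.natAbs), Nat.zero_le (x.den * y.den)]

lemma sizeMeasure_real : SizeMeasure (fun _ : ℝ => 1) (fun _ => 1) := by
  constructor <;> intros <;> norm_num

lemma one_le_ratBits (q : ℚ) : 1 ≤ ratBits q :=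
  (Nat.size_pos.mpr q.den_pos : 0 < Nat.size q.den).trans_le (Nat.le_add_left _ _)

/-! ### The approximation guarantee and the running time -/

section Main

variable {F : Type} [Field F] {sz ℓ : F → ℕ}

lemma SizeMeasure.sum_le (hℓ : SizeMeasure sz ℓ) (f : ℕ → F) (S : Finset ℕ) :
    ℓ (∑ k ∈ S, f k) ≤ ℓ 0 + ∑ k ∈ S, ℓ (f k) := by
  induction S using Finset.cons_induction with
  | empty => simp
  | cons x S hx ih =>
    rw [Finset.sum_cons, Finset.sum_cons]
    have := hℓ.add (f x) (∑ k ∈ S, f k)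
    omega

lemma SizeMeasure.natCast_le (hℓ : SizeMeasure sz ℓ) (i : ℕ) : ℓ (i : F) ≤ ℓ 0 + i * ℓ 1 := by
  simpa using hℓ.sum_le (fun _ => 1) (Finset.range i)

/-- A finite sequence, continued by zeros. -/
def extend {n : ℕ} (f : Fin n → F) (i : ℕ) : F := if h : i < n then f ⟨i, h⟩ else 0

@[simp]
lemma extend_val {n : ℕ} (f : Fin n → F) (i : Fin n) : extend f i = f i := by simp [extend]

lemma extend_self {n : ℕ} (f : Fin n → F) : extend f n = 0 := by simp [extend]

/-- The data of an instance. -/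
def Instance.data (I : Instance F) : Data F where
  n := I.n
  a := extend I.dR
  b := extend I.dI
  v := extend I.v
  C := I.C
  CR := I.CR
  CI := I.CI

lemma SizeMeasure.sum_extend_le (hℓ : SizeMeasure sz ℓ) {n : ℕ} (f : Fin n → F) {S : Finset ℕ}
    (hS : S ⊆ Finset.range n) : ℓ (∑ k ∈ S, extend f k) ≤ ℓ 0 + (∑ k, sz (f k) + n) := by
  refine (hℓ.sum_le _ S).trans (Nat.add_le_add_left ?_ _)
  refine (Finset.sum_le_sum_of_subset hS).trans ?_
  rw [← Fin.sum_univ_eq_sum_range (fun k => ℓ (extend f k))]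
  simp only [extend_val]
  refine (Finset.sum_le_sum fun k _ => hℓ.le_size (f k)).trans ?_
  simp [Finset.sum_add_distrib]

variable {I : Instance F}

omit [Field F] in
lemma Instance.n_le_size (hsz : ∀ x, 1 ≤ sz x) : I.n ≤ I.size sz := by
  have : ∑ _k : Fin I.n, 1 ≤ ∑ k, (sz (I.dR k) + sz (I.dI k) + sz (I.v k)) :=
    Finset.sum_le_sum fun k _ => (hsz (I.v k)).trans (Nat.le_add_left _ _)
  simp only [Finset.sum_const, Finset.card_univ, Fintype.card_fin, smul_eq_mul, mul_one] at this
  exact this.trans (Nat.le_add_left _ _)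

/-- The bound on the sizes of the stored numbers. -/
def sizeBound (ℓ : F → ℕ) (N z : ℕ) : ℕ :=
  (N * (z + 1) + 1) ^ 7 * (ℓ 1 + 1) + ℓ 0 + 2 * z + 1

lemma Instance.data_bounds (hℓ : SizeMeasure sz ℓ) (hsz : ∀ x, 1 ≤ sz x) (N : ℕ) :
    I.data.Bounds N ℓ (sizeBound ℓ N (I.size sz)) := by
  have hn := I.n_le_size hsz
  set z := I.size sz with hz
  have hmono : N * (I.n + 1) + 1 ≤ N * (z + 1) + 1 := by gcongr
  have hT : (N * (I.n + 1) + 1) ^ 7 ≤ (N * (z + 1) + 1) ^ 7 := by gcongr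
  have hself : N * (I.n + 1) + 1 ≤ (N * (I.n + 1) + 1) ^ 7 := Nat.le_self_pow (by norm_num) _
  have hsum : ∀ f : Fin I.n → F, ∑ k, sz (f k) ≤ z → ∀ S ⊆ Finset.range I.n,
      ℓ (∑ k ∈ S, extend f k) ≤ sizeBound ℓ N z := fun f hf S hS => by
    have := hℓ.sum_extend_le f hS
    simp only [sizeBound]
    omega
  have hparts : z = sz I.C + sz I.CR + sz I.CI +
      (∑ k, sz (I.dR k) + ∑ k, sz (I.dI k) + ∑ k, sz (I.v k)) := by
    rw [hz, Instance.size, Finset.sum_add_distrib, Finset.sum_add_distrib]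
  refine ⟨?_, ?_, fun i hi => ?_, hsum _ (by omega), hsum _ (by omega), hsum _ (by omega)⟩
  · change I.n ≤ _
    simp only [sizeBound]; omega
  · refine hT.trans ?_
    simp only [sizeBound]; nlinarith [Nat.zero_le ((N * (z + 1) + 1) ^ 7 * ℓ 1)]
  · have hi : i ≤ N * (I.n + 1) := hi
    have h1 : i * ℓ 1 ≤ (N * (z + 1) + 1) ^ 7 * ℓ 1 := Nat.mul_le_mul_right _ (by omega)
    have h2 := hℓ.natCast_le i
    simp only [sizeBound]; rw [mul_add]; omega

lemma Instance.init_bounded (hℓ : SizeMeasure sz ℓ) (hsz : ∀ x, 1 ≤ sz x) (N : ℕ) :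
    I.init.Bounded ℓ (sizeBound ℓ N (I.size sz)) := by
  have hn := I.n_le_size hsz
  have h : ∀ x, sz x ≤ I.size sz → ℓ x ≤ sizeBound ℓ N (I.size sz) := fun x hx => by
    have := hℓ.le_size x
    simp only [sizeBound]; omega
  have h0 : ℓ 0 ≤ sizeBound ℓ N (I.size sz) := by simp only [sizeBound]; omega
  have hk : ∀ k, sz (I.dR k) + sz (I.dI k) + sz (I.v k) ≤ I.size sz := fun k =>
    (Finset.single_le_sum (f := fun k => sz (I.dR k) + sz (I.dI k) + sz (I.v k))
      (fun _ _ => Nat.zero_le _) (Finset.mem_univ k)).trans (Nat.le_add_left _ _)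
  have hC : sz I.C + sz I.CR + sz I.CI ≤ I.size sz := Nat.le_add_right _ _
  constructor
  · intro a i
    simp only [Instance.init]
    split_ifs
    · refine (Nat.size_le_self _).trans ?_
      simp only [sizeBound]; omega
    · simp
  · intro a i
    simp only [Instance.init]
    split_ifs with _ _ _ _ hi
    · exact h _ (by omega)
    · exact h _ (by omega)
    · exact h _ (by omega)
    · exact h0
    · exact h _ ((hk ⟨i, hi⟩).trans' (by omega))
    · exact h _ ((hk ⟨i, hi⟩).trans' (by omega))
    · exact h _ ((hk ⟨i, hi⟩).trans' (by omega))
    · exact h0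
    · exact h0

lemma Instance.init_env : I.data.Env 0 I.init where
  n := rfl
  C := rfl
  CR := rfl
  CI := rfl
  a i := rfl
  b i := rfl
  v i := rfl
  cast i hi := by
    obtain rfl : i = 0 := Nat.le_zero.mp hi
    simp [Instance.init]

lemma sum_map_extend {n : ℕ} (ι : F →+* ℝ) (f : Fin n → F) (S : Finset (Fin n)) :
    ∑ k ∈ S, ι (f k) = ι (∑ k ∈ S.map Fin.valEmbedding, extend f k) := by
  simp [map_sum]

lemma map_val_subset {n : ℕ} (S : Finset (Fin n)) : S.map Fin.valEmbedding ⊆ Finset.range n :=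
  fun k hk => by
    obtain ⟨i, -, rfl⟩ := Finset.mem_map.mp hk
    exact Finset.mem_range.mpr i.2

/-! ### Transfer to the real numbers and the guarantee of the program -/

variable [LinearOrder F]

lemma norm_sum_le_iff {n : ℕ} (x y : Fin n → ℝ) (S : Finset (Fin n)) {C : ℝ} (hC : 0 ≤ C) :
    ‖∑ k ∈ S, (⟨x k, y k⟩ : ℂ)‖ ≤ C ↔
      (∑ k ∈ S, x k) * (∑ k ∈ S, x k) + (∑ k ∈ S, y k) * (∑ k ∈ S, y k) ≤ C * C := by
  rw [← pow_le_pow_iff_left₀ (norm_nonneg _) hC two_ne_zero, Complex.sq_norm,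
    Complex.normSq_apply, Complex.re_sum, Complex.im_sum, sq]

lemma Instance.feasible_iff {ι : F →+* ℝ} (hι : StrictMono ι) (hI : (I.map ι).Valid)
    (S : Finset (Fin I.n)) :
    (I.map ι).Feasible S ↔ I.data.Feas (S.map Fin.valEmbedding) := by
  have h := norm_sum_le_iff (fun k => ι (I.dR k)) (fun k => ι (I.dI k)) S (C := ι I.C) hI.C_pos.le
  change ‖∑ k ∈ S, (⟨ι (I.dR k), ι (I.dI k)⟩ : ℂ)‖ ≤ ι I.C ∧ ∑ k ∈ S, ι (I.dR k) ≤ ι I.CR ∧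
    ∑ k ∈ S, ι (I.dI k) ≤ ι I.CI ↔ _
  rw [h, sum_map_extend ι I.dR, sum_map_extend ι I.dI, ← map_mul, ← map_mul, ← map_mul, ← map_add,
    hι.le_iff_le, hι.le_iff_le, hι.le_iff_le]
  exact ⟨fun ⟨h, h', h''⟩ => ⟨h', h'', h⟩, fun ⟨h, h', h''⟩ => ⟨h'', h, h'⟩⟩

lemma extend_nonneg {n : ℕ} {f : Fin n → F} (h : ∀ k, 0 ≤ f k) (i : ℕ) : 0 ≤ extend f i := by
  unfold extend; split_ifs
  · exact h _
  · exact le_rfl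

variable [IsStrictOrderedRing F] [Archimedean F]

/-- Every feasible set is matched by a feasible candidate set. -/
lemma Data.exists_cand {D : Data F} {N : ℕ} (hN : 0 < N)
    (ha : ∀ k, 0 ≤ D.a k) (hb : ∀ k, 0 ≤ D.b k) (hv : ∀ k < D.n, 0 < D.v k)
    (han : D.a D.n = 0) (hbn : D.b D.n = 0) (hvn : D.v D.n = 0)
    {S : Finset ℕ} (hS : S ⊆ Finset.range D.n) (hF : D.Feas S) :
    ∃ c < (N * (D.n + 1) + 1) ^ 7, D.Feas (D.cand N c) ∧
      N * ∑ k ∈ S, D.v k ≤ 2 * (N + 1) * ∑ k ∈ D.cand N c, D.v k := by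
  obtain ⟨d, hd, h1, h2, h3⟩ := exists_candidate hN ha hb hv han hbn hvn hS
  obtain ⟨c, hc, hcd⟩ := exists_digits _ 7 d hd
  have e : D.cand N c = candidate D.n D.a D.b D.v d := candidate_congr hcd
  refine ⟨c, hc, ?_, by rw [e]; exact h3⟩
  rw [e]
  have p1 : 0 ≤ ∑ k ∈ candidate D.n D.a D.b D.v d, D.a k := Finset.sum_nonneg fun k _ => ha k
  have p2 : 0 ≤ ∑ k ∈ candidate D.n D.a D.b D.v d, D.b k := Finset.sum_nonneg fun k _ => hb k
  exact ⟨h1.trans hF.1, h2.trans hF.2.1, hF.2.2.trans'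
    (add_le_add (mul_self_le_mul_self p1 h1) (mul_self_le_mul_self p2 h2))⟩

open Polynomial in
theorem isPolyTimeApprox_program {ι : F →+* ℝ} (hι : StrictMono ι) (hℓ : SizeMeasure sz ℓ)
    (hsz : ∀ x, 1 ≤ sz x) {N : ℕ} (hN : 0 < N) {ρ : ℝ} (hρ : ρ * (2 * (N + 1)) ≤ N) :
    IsPolyTimeApprox ι sz ρ (Algo.program N) := by
  -- `base` bounds the number of candidates. The factors below are one more than the number of
  -- items, one more than the number of candidates, and the weight of the program times `sizeBound`
  -- plus one.
  let base : ℕ[X] := ((N : ℕ[X]) * (X + 1) + 1) ^ 7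
  refine ⟨(X + 1) * (base + 1) * (((Algo.program N).wt ℓ : ℕ[X]) *
    (base * ((ℓ 1 : ℕ[X]) + 1) + (ℓ 0 : ℕ[X]) + 2 * X + 1 + 1)), fun I hI => ?_⟩
  have pos : ∀ x : F, 0 ≤ ι x → 0 ≤ x := fun x hx => by rwa [← map_zero ι, hι.le_iff_le] at hx
  have pos' : ∀ x : F, 0 < ι x → 0 < x := fun x hx => by rwa [← map_zero ι, hι.lt_iff_lt] at hx
  have hv : ∀ k, 0 < I.v k := fun k => pos' _ (hI.v_pos k)
  have ha : ∀ k, 0 ≤ I.data.a k := extend_nonneg fun k => pos _ (hI.dR_nonneg k)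
  have hb : ∀ k, 0 ≤ I.data.b k := extend_nonneg fun k => pos _ (hI.dI_nonneg k)
  have hv0 : ∀ k, 0 ≤ I.data.v k := extend_nonneg fun k => (hv k).le
  have hvp : ∀ k < I.data.n, 0 < I.data.v k := fun k hk => by
    have hk : k < I.n := hk
    simpa [Instance.data, extend, hk] using hv ⟨k, hk⟩
  have hcand := fun {S : Finset ℕ} (hS : S ⊆ Finset.range I.data.n) (hF : I.data.Feas S) =>
    Data.exists_cand hN ha hb hvp (extend_self _) (extend_self _) (extend_self _) hS hF
  obtain ⟨σ, t, hex, ht, ⟨m, x, hbest, hout⟩, -⟩ :=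
    Data.program_triple hℓ (Instance.data_bounds hℓ hsz N) (fun S _ => Finset.sum_nonneg
      fun k _ => hv0 k) I.init ⟨Instance.init_env, fun a ha' i => by simp [Instance.init, ha'],
        by simp [Instance.init]⟩ (Instance.init_bounded hℓ hsz N)
  have hS : ((I.map ι).output σ).map Fin.valEmbedding = I.data.cand N m := by
    ext k
    rw [Finset.mem_map]
    constructor
    · rintro ⟨i, hi, rfl⟩
      exact (hout i i.2).mp (Finset.mem_filter.mp hi).2
    · intro hk
      have hkn := Finset.mem_range.mp (Data.cand_subset m hk)
      exact ⟨⟨k, hkn⟩, Finset.mem_filter.mpr ⟨Finset.mem_univ _, (hout k hkn).mpr hk⟩, rfl⟩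
  have hempty : I.data.Feas ∅ := by
    have h1 : 0 < I.C := pos' _ hI.C_pos
    have h2 : 0 < I.CR := pos' _ hI.CR_pos
    have h3 : 0 < I.CI := pos' _ hI.CI_pos
    simpa [Data.Feas, Instance.data] using ⟨h2.le, h3.le, (mul_pos h1 h1).le⟩
  -- The empty set is feasible, hence matched by a feasible candidate, so the search cannot end
  -- without a record.
  obtain ⟨hFm, hxm⟩ : I.data.Feas (I.data.cand N m) ∧ ∑ k ∈ I.data.cand N m, I.data.v k = x := by
    obtain ⟨c, hc, hF, -⟩ := hcand (Finset.empty_subset _) hempty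
    exact hbest.attained.resolve_left fun h => h.2 c hc hF
  refine ⟨σ, t, hex, ht.trans ?_, ?_, fun S hSopt => ?_⟩
  · have hn := I.n_le_size hsz
    simp only [eval_mul, eval_add, eval_pow, eval_X, eval_one, eval_natCast, base, sizeBound,
      eval_ofNat, Nat.cast_id]
    change (I.n + 1) * ((N * (I.n + 1) + 1) ^ 7 + 1) * _ ≤ _
    gcongr
  · exact (Instance.feasible_iff hι hI _).mpr (hS ▸ hFm)
  · obtain ⟨c, hc, hF, hval⟩ := hcand (map_val_subset _)
      ((Instance.feasible_iff hι hI S).mp hSopt.1)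
    have h1 : (N : F) * ∑ k ∈ S.map Fin.valEmbedding, I.data.v k ≤ 2 * (N + 1) * x :=
      hval.trans (mul_le_mul_of_nonneg_left (hbest.ge c hc hF) (by positivity))
    have e1 : (I.map ι).value S = ι (∑ k ∈ S.map Fin.valEmbedding, I.data.v k) :=
      sum_map_extend ι I.v S
    have e2 : (I.map ι).value ((I.map ι).output σ) = ι x := by
      rw [← hxm, ← hS]
      exact sum_map_extend ι I.v _
    have h2 := hι.monotone h1
    simp only [map_mul, map_natCast, map_add, map_one, map_ofNat] at h2
    rw [e1, e2]
    have h3 : 0 ≤ ι (∑ k ∈ S.map Fin.valEmbedding, I.data.v k) := by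
      rw [← map_zero ι]
      exact hι.monotone (Finset.sum_nonneg fun k _ => hv0 k)
    have h4 := mul_le_mul_of_nonneg_right hρ h3
    refine le_of_mul_le_mul_left ?_ (by positivity : (0 : ℝ) < 2 * (N + 1))
    linarith

end Main

end GCKP

end

theorem corollary4 (ε : ℝ) (hε : 0 < ε) :
    ∃ P : GCKP.Program,
      -- rational inputs in binary, bit cost
      GCKP.IsPolyTimeApprox (F := ℚ) (fun q => (q : ℝ)) GCKP.ratBits (1 / 2 - ε) P ∧
      -- real inputs, every real number having size one and real arithmetic having unit cost
      GCKP.IsPolyTimeApprox (F := ℝ) (fun x => x) (fun _ => 1) (1 / 2 - ε) P := by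
  -- The ratio `N / (2 * (N + 1))` is at least `1 / 2 - ε` exactly when `1 ≤ 2 * ε * (N + 1)`.
  obtain ⟨N, hN⟩ := exists_nat_gt (1 / (2 * ε))
  have hpos : 0 < N := by
    have : (0 : ℝ) < N := hN.trans' (by positivity)
    exact_mod_cast this
  have hρ : (1 / 2 - ε) * (2 * (N + 1)) ≤ N := by
    rw [div_lt_iff₀ (by positivity)] at hN
    linarith
  exact ⟨GCKP.Algo.program N,
    GCKP.isPolyTimeApprox_program (ι := Rat.castHom ℝ) Rat.cast_strictMono GCKP.sizeMeasure_rat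
      GCKP.one_le_ratBits hpos hρ,
    GCKP.isPolyTimeApprox_program (ι := RingHom.id ℝ) strictMono_id GCKP.sizeMeasure_real
      (fun _ => le_rfl) hpos hρ⟩
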